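/- A quadratic Pisot unit is a real algebraic integer $\beta>1$ of degree $2$ whose conjugate has modulus less than $1$ and whose inverse is an algebraic integer. For a finite set $\mathcal A\subset\mathbb Z$ and $\alpha\in\mathbb R$ put $$X^{\mathcal A}(\alpha)=\Big\{\sum_{j=0}^n a_j\alpha^j : n\in\mathbb N,\ a_j\in\mathcal A\Big\}.$$ An exchange of three intervals with parameters $0<\lambda\le\mu<1$ is the bijection $T:J\to J$ of an interval $J$ with end-points $0$ and $1$ (each of which may or may not belong to $J$), where $J$ is the disjoint union of intervals $I_A,I_B,I_C$ with end-points $0,\lambda$; $\lambda,\mu$; $\mu,1$ respectively, and $T(x)=x+1-\lambda$ on $I_A$, $T(x)=x+1-\lambda-\mu$ on $I_B$, $T(x)=x-\mu$ on $I_C$ (for $\lambda=\mu$ this is an exchange of two intervals). A bidirectional sequence $(u_n)_{n\in\mathbb Z}$ codes the orbit of $\rho\in J$ if, for distinct letters $A,B,C$, one has $u_n=X$ whenever $T^n(\rho)\in I_X$, $X\in\{A,B,C\}$. **Theorem.** Let $\beta$ be a quadratic Pisot unit and let $\mathcal A\ni 0$ be a finite set of consecutive integers with $\#\mathcal A>\beta$.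 Let $\alpha=-\beta$, or $\alpha=\beta$ and $\{-1,0,1\}\subset\mathcal A$. Then there exist distinct $\Delta_1,\Delta_2>0$ such that the distances between consecutive points of $X^{\mathcal A}(\alpha)$ take values in $\{\Delta_1,\Delta_2,\Delta_1+\Delta_2\}$. Moreover, $X^{\mathcal A}(\alpha)$ is the range of a strictly increasing sequence $(y_n)_{n\in\mathbb Z}$, and the bidirectional sequence of gaps $(y_{n+1}-y_n)_{n\in\mathbb Z}$ is a coding of the orbit of a point under an exchange of three intervals, where the gaps $\Delta_1$, $\Delta_1+\Delta_2$, $\Delta_2$ stand for the letters $A$, $B$, $C$. Let $\alpha'$ be the algebraic conjugate of $\alpha$. Unless $\inf X^{\mathcal A}(\alpha')$ and $\sup X^{\mathcal A}(\alpha')$ both belong to $\mathbb Z[\beta]\setminus X^{\mathcal A}(\alpha')$, the exchange can be taken with $J=[0,1)$, $I_A=[0,\lambda)$, $I_B=[\lambda,\mu)$, $I_C=[\mu,1)$. -/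

import Mathlib

/-- `β` is a quadratic Pisot unit: a real algebraic integer of degree two, larger than `1`, all of
whose other conjugates have modulus less than `1`, and whose inverse is an algebraic integer. -/
structure IsQuadraticPisotUnit (β : ℝ) : Prop where
  one_lt : 1 < β
  isIntegral : IsIntegral ℤ β
  isIntegral_inv : IsIntegral ℤ β⁻¹
  natDegree_minpoly : (minpoly ℚ β).natDegree = 2
  norm_conj_lt_one : ∀ z : ℂ, Polynomial.aeval z (minpoly ℚ β) = 0 → z ≠ (β : ℂ) → ‖z‖ < 1

/-- The spectrum `X^A(α)`: all numbers `∑_{j=0}^n a_j α^j` with `n ∈ ℕ` and digits `a_j ∈ A`. -/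
def digitSpectrum (A : Finset ℤ) (α : ℝ) : Set ℝ :=
  {x | ∃ (n : ℕ) (a : ℕ → ℤ), (∀ j, a j ∈ A) ∧ x = ∑ j ∈ Finset.range (n + 1), (a j : ℝ) * α ^ j}

/-- `x < y` are consecutive points of `X`. -/
def AreConsecutive (X : Set ℝ) (x y : ℝ) : Prop :=
  x ∈ X ∧ y ∈ X ∧ x < y ∧ ∀ z ∈ X, ¬ (x < z ∧ z < y)

/-- `T` is the exchange of the three consecutive intervals `IA`, `IB`, `IC`, which partition the
unit interval `J` (each of the end-points `0`, `1` may or may not belong to `J`) and have the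
end-points `0, lam`, `lam, mu` and `mu, 1`; when `lam = mu` it is an exchange of two intervals.
The map is the usual one: the intervals are translated so that their order in `J` is reversed. -/
structure IsThreeIntervalExchange (lam mu : ℝ) (J IA IB IC : Set ℝ) (T : Equiv.Perm J) :
    Prop where
  lam_pos : 0 < lam
  lam_le_mu : lam ≤ mu
  mu_lt_one : mu < 1
  Ioo_subset_J : Set.Ioo 0 1 ⊆ J
  J_subset_Icc : J ⊆ Set.Icc 0 1
  union_eq : IA ∪ IB ∪ IC = J
  disjoint_AB : Disjoint IA IB
  disjoint_AC : Disjoint IA IC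
  disjoint_BC : Disjoint IB IC
  Ioo_subset_A : Set.Ioo 0 lam ⊆ IA
  A_subset_Icc : IA ⊆ Set.Icc 0 lam
  Ioo_subset_B : Set.Ioo lam mu ⊆ IB
  B_subset_Icc : IB ⊆ Set.Icc lam mu
  Ioo_subset_C : Set.Ioo mu 1 ⊆ IC
  C_subset_Icc : IC ⊆ Set.Icc mu 1
  apply_A : ∀ x : J, (x : ℝ) ∈ IA → (T x : ℝ) = x + 1 - lam
  apply_B : ∀ x : J, (x : ℝ) ∈ IB → (T x : ℝ) = x + 1 - lam - mu
  apply_C : ∀ x : J, (x : ℝ) ∈ IC → (T x : ℝ) = x - mu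

/-- All the intervals are left-closed and right-open: `J = [0,1)`, `IA = [0,lam)`,
`IB = [lam,mu)`, `IC = [mu,1)`. -/
def AreLeftClosedRightOpen (lam mu : ℝ) (J IA IB IC : Set ℝ) : Prop :=
  J = Set.Ico 0 1 ∧ IA = Set.Ico 0 lam ∧ IB = Set.Ico lam mu ∧ IC = Set.Ico mu 1

/-- The bidirectional sequence `g` codes the orbit of `ρ` under the exchange `T` of the intervals
`IA`, `IB`, `IC`: the letters of the intervals visited are `δA`, `δB`, `δC`. -/
def CodesOrbit (g : ℤ → ℝ) (δA δB δC : ℝ) (J IA IB IC : Set ℝ) (T : Equiv.Perm J) (ρ : J) : Prop :=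
  ∀ n : ℤ, (((T ^ n) ρ : ℝ) ∈ IA → g n = δA) ∧ (((T ^ n) ρ : ℝ) ∈ IB → g n = δB) ∧
    (((T ^ n) ρ : ℝ) ∈ IC → g n = δC)

/-! Conjugation turns `X^A(α)` into a cut-and-project set. Elements of `ℤ[α]` are pairs `(u, v)`,
read as `u + v α` by `linEval α` and as the conjugate `u + v α'` by `linEval α'`. Conjugating digit
expansions shows that a point is in `X^A(α)` iff its conjugate is in `X^A(α')`. As `|α'| < 1`, the
latter set lies in the interval `[s - r, s + r]` invariant under the maps `x ↦ d + α' x`, `d ∈ A`.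

The arithmetic core is `FillsWindow`: every element of `ℤ[α]` with conjugate inside this window is
in the spectrum. Since `#A > |α|`, the images of the open window under these maps cover it, so such
a `z` can be written `d + α w` with the conjugate of `w` again in the window. Division by `α`
contracts, so a counterexample closest to the fixed point `c` of `x ↦ (a + b) / 2 + α x` lies in an
explicit bounded region. For minimal alphabets, the few elements of `ℤ[α]` left there are sums `u +
v α` with digits `u, v`; larger alphabets follow by enlarging the window step by step.

The gaps are then a three-gap statement (`exists_codesOrbit_of_cutAndProject`): with `Δ₁`, `Δ₂` the
shortest positive steps whose rescaled conjugates lie in `(0, 1)` and `(-1, 0)`, the successor of a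
point is reached by `Δ₁`, `Δ₂` or `Δ₁ + Δ₂`, according to the position of its conjugate in the
window, and the conjugates move by the exchange. At most one end-point of the window belongs to
`X^A(α')` (`not_both_endpoints_mem`), so after a possible reflection the window is `[0, 1)` or `(0,
1)`. -/

/-! ### Bidirectional enumeration and the model interval exchange. -/

/-- A nonempty set of reals that is locally finite and unbounded in both directions is the range of
a strictly increasing bidirectional sequence. -/
theorem exists_strictMono_int_range_eq {X : Set ℝ} (hne : X.Nonempty)
    (hfin : ∀ a b : ℝ, (X ∩ Set.Icc a b).Finite) (hmax : ∀ x ∈ X, ∃ y ∈ X, x < y)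
    (hmin : ∀ x ∈ X, ∃ y ∈ X, y < x) : ∃ y : ℤ → ℝ, StrictMono y ∧ Set.range y = X := by
  classical
  have hf : ∀ a b : X, (Set.Icc a b).Finite := by
    intro a b
    refine Set.Finite.of_finite_image ((hfin a b).subset ?_) Subtype.val_injective.injOn
    rintro _ ⟨c, hc, rfl⟩
    exact ⟨c.2, hc.1, hc.2⟩
  let _ : LocallyFiniteOrder X := LocallyFiniteOrder.ofFiniteIcc hf
  let _ : SuccOrder X := LinearLocallyFiniteOrder.succOrder X
  let _ : PredOrder X := LinearLocallyFiniteOrder.predOrder X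
  have _ : Nonempty X := hne.to_subtype
  have _ : NoMaxOrder X := ⟨fun x => by
    obtain ⟨y, hy, h⟩ := hmax x x.2
    exact ⟨⟨y, hy⟩, h⟩⟩
  have _ : NoMinOrder X := ⟨fun x => by
    obtain ⟨y, hy, h⟩ := hmin x x.2
    exact ⟨⟨y, hy⟩, h⟩⟩
  let e : X ≃o ℤ := orderIsoIntOfLinearSuccPredArch
  refine ⟨fun n => e.symm n, fun a b h => e.symm.strictMono h, ?_⟩
  ext x
  constructor
  · rintro ⟨n, rfl⟩
    exact (e.symm n).2
  · intro hx
    exact ⟨e ⟨x, hx⟩, by simp⟩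

theorem areConsecutive_of_strictMono {X : Set ℝ} {y : ℤ → ℝ} (hy : StrictMono y)
    (hX : Set.range y = X) (n : ℤ) : AreConsecutive X (y n) (y (n + 1)) := by
  subst hX
  refine ⟨⟨n, rfl⟩, ⟨n + 1, rfl⟩, hy (by omega), ?_⟩
  rintro _ ⟨k, rfl⟩ ⟨h1, h2⟩
  rw [hy.lt_iff_lt] at h1 h2
  omega

open Classical in
/-- The three-interval exchange on `J` with translations `δ₁`, `δ₁ + δ₂`, `δ₂`. -/
noncomputable def intervalExchange (J : Set ℝ) (hJ : J = Set.Ico 0 1 ∨ J = Set.Ioo 0 1)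
    (δ₁ δ₂ : ℝ) (h1 : 0 < δ₁) (h1' : δ₁ < 1) (h2 : δ₂ < 0) (h2' : -1 < δ₂) (h : 1 ≤ δ₁ - δ₂) :
    Equiv.Perm J where
  -- Testing which translate stays in `J`, rather than comparing `x` with the break points, settles
  -- the end-points for both shapes of `J`. For `J = (0, 1)` the middle piece is the closed interval
  -- `[1 - δ₁, -δ₂]`, a single point if `δ₁ - δ₂ = 1`.
  toFun x := ⟨if (x : ℝ) + δ₁ ∈ J then x + δ₁ else if (x : ℝ) + δ₂ ∈ J then x + δ₂ else
      x + δ₁ + δ₂, by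
    obtain ⟨x, hx⟩ := x
    rcases hJ with rfl | rfl <;> simp only [Set.mem_Ico, Set.mem_Ioo] at * <;> grind⟩
  invFun x := ⟨if (x : ℝ) - δ₁ ∈ J then x - δ₁ else if (x : ℝ) - δ₂ ∈ J then x - δ₂ else
      x - δ₁ - δ₂, by
    obtain ⟨x, hx⟩ := x
    rcases hJ with rfl | rfl <;> simp only [Set.mem_Ico, Set.mem_Ioo] at * <;> grind⟩
  left_inv := by
    rintro ⟨x, hx⟩
    rcases hJ with rfl | rfl <;> simp only [Set.mem_Ico, Set.mem_Ioo, Subtype.mk.injEq] at * <;>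
      grind
  right_inv := by
    rintro ⟨x, hx⟩
    rcases hJ with rfl | rfl <;> simp only [Set.mem_Ico, Set.mem_Ioo, Subtype.mk.injEq] at * <;>
      grind

theorem isThreeIntervalExchange_intervalExchange (J : Set ℝ)
    (hJ : J = Set.Ico 0 1 ∨ J = Set.Ioo 0 1)
    (δ₁ δ₂ : ℝ) (h1 : 0 < δ₁) (h1' : δ₁ < 1) (h2 : δ₂ < 0) (h2' : -1 < δ₂) (h : 1 ≤ δ₁ - δ₂) :
    IsThreeIntervalExchange (1 - δ₁) (-δ₂) J {x | x ∈ J ∧ x + δ₁ ∈ J}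
      {x | x ∈ J ∧ x + δ₁ ∉ J ∧ x + δ₂ ∉ J} {x | x ∈ J ∧ x + δ₂ ∈ J}
      (intervalExchange J hJ δ₁ δ₂ h1 h1' h2 h2' h) where
  lam_pos := by linarith
  lam_le_mu := by linarith
  mu_lt_one := by linarith
  Ioo_subset_J := by
    rcases hJ with rfl | rfl
    · exact Set.Ioo_subset_Ico_self
    · exact subset_rfl
  J_subset_Icc := by
    rcases hJ with rfl | rfl
    · exact Set.Ico_subset_Icc_self
    · exact Set.Ioo_subset_Icc_self
  union_eq := by
    ext x
    simp only [Set.mem_union, Set.mem_ofPred_eq]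
    tauto
  disjoint_AB := by
    rw [Set.disjoint_left]
    rintro x ⟨-, hx⟩ ⟨-, hx', -⟩
    exact hx' hx
  disjoint_AC := by
    rw [Set.disjoint_left]
    rintro x ⟨-, hx⟩ ⟨-, hx'⟩
    rcases hJ with rfl | rfl <;> linarith [hx.1, hx.2, hx'.1, hx'.2]
  disjoint_BC := by
    rw [Set.disjoint_left]
    rintro x ⟨-, -, hx⟩ ⟨-, hx'⟩
    exact hx hx'
  Ioo_subset_A := by
    rintro x ⟨hx, hx'⟩
    rcases hJ with rfl | rfl <;> simp only [Set.mem_Ico, Set.mem_Ioo, Set.mem_ofPred_eq] <;> grind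
  A_subset_Icc := by
    rintro x ⟨hx, hx'⟩
    rcases hJ with rfl | rfl <;> simp only [Set.mem_Ico, Set.mem_Ioo, Set.mem_Icc] at * <;> grind
  Ioo_subset_B := by
    rintro x ⟨hx, hx'⟩
    rcases hJ with rfl | rfl <;> simp only [Set.mem_Ico, Set.mem_Ioo, Set.mem_ofPred_eq] <;> grind
  B_subset_Icc := by
    rintro x ⟨hx, hx', hx''⟩
    rcases hJ with rfl | rfl <;> simp only [Set.mem_Ico, Set.mem_Ioo, Set.mem_Icc] at * <;> grind
  Ioo_subset_C := by
    rintro x ⟨hx, hx'⟩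
    rcases hJ with rfl | rfl <;> simp only [Set.mem_Ico, Set.mem_Ioo, Set.mem_ofPred_eq] <;> grind
  C_subset_Icc := by
    rintro x ⟨hx, hx'⟩
    rcases hJ with rfl | rfl <;> simp only [Set.mem_Ico, Set.mem_Ioo, Set.mem_Icc] at * <;> grind
  apply_A := by
    rintro x ⟨hx, hx'⟩
    simp only [intervalExchange, Equiv.coe_fn_mk, hx', if_true]
    ring
  apply_B := by
    rintro x ⟨hx, hx', hx''⟩
    simp only [intervalExchange, Equiv.coe_fn_mk, hx', hx'', if_false]
    ring
  apply_C := by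
    rintro x ⟨hx, hx'⟩
    have hx'' : (x : ℝ) + δ₁ ∉ J := by
      rcases hJ with rfl | rfl <;> simp only [Set.mem_Ico, Set.mem_Ioo] at * <;> grind
    simp only [intervalExchange, Equiv.coe_fn_mk, hx', hx'', if_false, if_true]
    ring

theorem areLeftClosedRightOpen_Ico {δ₁ δ₂ : ℝ} (h1 : 0 < δ₁) (h1' : δ₁ < 1)
    (h2' : -1 < δ₂) (h : 1 ≤ δ₁ - δ₂) :
    AreLeftClosedRightOpen (1 - δ₁) (-δ₂) (Set.Ico 0 1)
      {x | x ∈ Set.Ico (0 : ℝ) 1 ∧ x + δ₁ ∈ Set.Ico (0 : ℝ) 1}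
      {x | x ∈ Set.Ico (0 : ℝ) 1 ∧ x + δ₁ ∉ Set.Ico (0 : ℝ) 1 ∧ x + δ₂ ∉ Set.Ico (0 : ℝ) 1}
      {x | x ∈ Set.Ico (0 : ℝ) 1 ∧ x + δ₂ ∈ Set.Ico (0 : ℝ) 1} := by
  refine ⟨rfl, ?_, ?_, ?_⟩ <;> ext x <;> simp only [Set.mem_Ico, Set.mem_ofPred_eq] <;> grind

/-! ### Three gaps in one-dimensional cut-and-project sets. -/

section CutAndProject

variable {G : Type*} [AddCommGroup G] {f g : G →+ ℝ} {Δ₁ Δ₂ : G}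

/-- `Δ` is the smallest positive element whose image under `g` lies in the set `S`. -/
def IsLeastStep (f g : G →+ ℝ) (S : Set ℝ) (Δ : G) : Prop :=
  0 < f Δ ∧ g Δ ∈ S ∧ ∀ z, 0 < f z → g z ∈ S → f Δ ≤ f z

theorem exists_isLeastStep (hfin : ∀ C : ℝ, {z | |f z| ≤ C ∧ |g z| ≤ C}.Finite) {S : Set ℝ}
    (hS : ∀ s ∈ S, |s| ≤ 1) (hne : ∃ z, 0 < f z ∧ g z ∈ S) : ∃ Δ, IsLeastStep f g S Δ := by
  obtain ⟨z₀, hz₀, hz₀'⟩ := hne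
  have hF : {z | 0 < f z ∧ f z ≤ f z₀ ∧ g z ∈ S}.Finite := by
    refine (hfin (max 1 (f z₀))).subset ?_
    rintro z ⟨h1, h2, h3⟩
    exact ⟨by rw [abs_of_pos h1]; exact h2.trans (le_max_right _ _),
      (hS _ h3).trans (le_max_left _ _)⟩
  obtain ⟨Δ, ⟨h1, h2, h3⟩, h4⟩ := Set.exists_min_image _ f hF ⟨z₀, hz₀, le_rfl, hz₀'⟩
  refine ⟨Δ, h1, h3, fun z hz hz' => ?_⟩
  rcases le_total (f z) (f z₀) with h | h
  · exact h4 z ⟨hz, h, hz'⟩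
  · exact h2.trans h

/-- Otherwise the difference of the two steps, taken with positive image under `f`, would be a
shorter step with image under `g` on the side of the longer one. The inequality says that the break
points of the exchange are in the right order, and that at most one of the two steps keeps a point
in the window. -/
theorem one_le_sub_of_isLeastStep (hf : Function.Injective f)
    (h1 : IsLeastStep f g (Set.Ioo 0 1) Δ₁) (h2 : IsLeastStep f g (Set.Ioo (-1) 0) Δ₂) :
    1 ≤ g Δ₁ - g Δ₂ := by
  obtain ⟨p1, ⟨q1, r1⟩, m1⟩ := h1
  obtain ⟨p2, ⟨q2, r2⟩, m2⟩ := h2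
  by_contra! hlt
  rcases lt_trichotomy (f Δ₁) (f Δ₂) with h | h | h
  · have := m2 (Δ₂ - Δ₁) (by simpa using h) (by simp only [map_sub]; constructor <;> linarith)
    rw [map_sub] at this
    linarith
  · rw [hf h] at q1
    linarith
  · have := m1 (Δ₁ - Δ₂) (by simpa using h) (by simp only [map_sub]; constructor <;> linarith)
    rw [map_sub] at this
    linarith

/-- Subtracting from `w` the least step on its own side leaves a positive step that falls on the
other side, hence is at least the least step there. -/
theorem add_le_of_lt_isLeastStep (hf : Function.Injective f)
    (h1 : IsLeastStep f g (Set.Ioo 0 1) Δ₁) (h2 : IsLeastStep f g (Set.Ioo (-1) 0) Δ₂) {w : G}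
    (hw : 0 < f w) (hw' : (0 < g w ∧ g w < g Δ₁) ∨ (g w < 0 ∧ g Δ₂ < g w)) :
    f Δ₁ + f Δ₂ ≤ f w := by
  obtain ⟨p1, ⟨q1, r1⟩, m1⟩ := h1
  obtain ⟨p2, ⟨q2, r2⟩, m2⟩ := h2
  rcases hw' with ⟨a, b⟩ | ⟨a, b⟩
  · have h := m1 w hw ⟨a, by linarith⟩
    have h' : f Δ₁ ≠ f w := fun h => by rw [hf h] at b; exact lt_irrefl _ b
    have := m2 (w - Δ₁) (by rw [map_sub]; linarith [lt_of_le_of_ne h h'])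
      (by simp only [map_sub]; constructor <;> linarith)
    rw [map_sub] at this
    linarith
  · have h := m2 w hw ⟨by linarith, a⟩
    have h' : f Δ₂ ≠ f w := fun h => by rw [hf h] at b; exact lt_irrefl _ b
    have := m1 (w - Δ₂) (by rw [map_sub]; linarith [lt_of_le_of_ne h h'])
      (by simp only [map_sub]; constructor <;> linarith)
    rw [map_sub] at this
    linarith

/-- The next point of a cut-and-project set with window `J + t`. -/
theorem eq_of_areConsecutive_cutAndProject (hf : Function.Injective f) (hg : Function.Injective g)
    (h1 : IsLeastStep f g (Set.Ioo 0 1) Δ₁) (h2 : IsLeastStep f g (Set.Ioo (-1) 0) Δ₂)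
    {t : ℝ} {J : Set ℝ} (hJ : J = Set.Ico 0 1 ∨ J = Set.Ioo 0 1) {x y : G}
    (hxy : AreConsecutive {r | ∃ z, f z = r ∧ g z - t ∈ J} (f x) (f y)) :
    (g x - t + g Δ₁ ∈ J → y = x + Δ₁) ∧ (g x - t + g Δ₂ ∈ J → y = x + Δ₂) ∧
    (g x - t + g Δ₁ ∉ J → g x - t + g Δ₂ ∉ J → y = x + (Δ₁ + Δ₂)) := by
  have hle := one_le_sub_of_isLeastStep hf h1 h2
  have hB := fun w => add_le_of_lt_isLeastStep (w := w) hf h1 h2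
  obtain ⟨p1, ⟨q1, r1⟩, m1⟩ := h1
  obtain ⟨p2, ⟨q2, r2⟩, m2⟩ := h2
  obtain ⟨⟨x', hx', hx⟩, ⟨y', hy', hy⟩, hlt, hno⟩ := hxy
  obtain rfl := hf hx'
  obtain rfl := hf hy'
  obtain ⟨w, rfl⟩ : ∃ w, y' = x' + w := ⟨y' - x', by abel⟩
  have hw : 0 < f w := by rw [map_add] at hlt; linarith
  have hgw : g w ≠ 0 := by
    intro h
    rw [← map_zero g] at h
    rw [hg h, map_zero] at hw
    exact lt_irrefl _ hw
  -- An admissible step no longer than the gap must be the gap, since no point lies strictly in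
  -- between. It remains to bound the gap from below by each candidate step.
  have key : ∀ d : G, 0 < f d → f d ≤ f w → g x' - t + g d ∈ J → x' + w = x' + d := by
    intro d hd hdw hdJ
    by_contra hne
    refine hno (f (x' + d)) ⟨x' + d, rfl, ?_⟩ ⟨?_, ?_⟩
    · rw [map_add, add_sub_right_comm]; exact hdJ
    · rw [map_add]; linarith
    · refine lt_of_le_of_ne ?_ fun h => hne (hf h).symm
      rw [map_add, map_add]; linarith
  have hy2 : g x' - t + g w ∈ J := by rwa [map_add, add_sub_right_comm] at hy
  have hp : ∀ p, p ∈ J → 0 ≤ p ∧ p < 1 := by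
    rcases hJ with rfl | rfl
    · exact fun p hp => hp
    · exact fun p hp => ⟨hp.1.le, hp.2⟩
  refine ⟨fun hA => key Δ₁ p1 ?_ hA, fun hC => key Δ₂ p2 ?_ hC, fun hA hC => key _ ?_ ?_ ?_⟩
  · rcases hgw.lt_or_gt with h | h
    · have := hB w hw (Or.inr ⟨h, by linarith [(hp _ hA).2, (hp _ hy2).1]⟩)
      linarith
    · exact m1 w hw ⟨h, by linarith [(hp _ hx).1, (hp _ hy2).2]⟩
  · rcases hgw.lt_or_gt with h | h
    · exact m2 w hw ⟨by linarith [(hp _ hx).2, (hp _ hy2).1], h⟩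
    · have := hB w hw (Or.inl ⟨h, by linarith [(hp _ hC).1, (hp _ hy2).2]⟩)
      linarith
  · rw [map_add]; linarith
  · rw [map_add]
    apply hB w hw
    rcases hJ with rfl | rfl <;> simp only [Set.mem_Ico, Set.mem_Ioo] at * <;> grind
  · rw [map_add]
    rcases hJ with rfl | rfl <;> simp only [Set.mem_Ico, Set.mem_Ioo] at * <;> grind

/-- Three-gap theorem for cut-and-project sets: the gaps code an orbit of a three-interval
exchange. -/
theorem exists_codesOrbit_of_cutAndProject (hf : Function.Injective f) (hg : Function.Injective g)
    (hfin : ∀ C : ℝ, {z | |f z| ≤ C ∧ |g z| ≤ C}.Finite)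
    (hpos : ∃ z, 0 < f z ∧ g z ∈ Set.Ioo 0 1) (hneg : ∃ z, 0 < f z ∧ g z ∈ Set.Ioo (-1) 0)
    {t : ℝ} {J : Set ℝ} (hJ : J = Set.Ico 0 1 ∨ J = Set.Ioo 0 1) {X : Set ℝ}
    (hX : X = {r | ∃ z, f z = r ∧ g z - t ∈ J}) (hne : X.Nonempty) :
    ∃ Δ₁ Δ₂ : ℝ, 0 < Δ₁ ∧ 0 < Δ₂ ∧ Δ₁ ≠ Δ₂ ∧
      (∀ x y : ℝ, AreConsecutive X x y → y - x ∈ ({Δ₁, Δ₂, Δ₁ + Δ₂} : Set ℝ)) ∧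
      ∃ y : ℤ → ℝ, StrictMono y ∧ Set.range y = X ∧
        ∃ (lam mu : ℝ) (IA IB IC : Set ℝ) (T : Equiv.Perm J) (ρ : J),
          IsThreeIntervalExchange lam mu J IA IB IC T ∧
          CodesOrbit (fun n => y (n + 1) - y n) Δ₁ (Δ₁ + Δ₂) Δ₂ J IA IB IC T ρ ∧
          (J = Set.Ico 0 1 → AreLeftClosedRightOpen lam mu J IA IB IC) := by
  obtain ⟨Δ₁, hΔ₁⟩ := exists_isLeastStep (S := Set.Ioo 0 1) hfin
    (fun s hs => abs_le.2 ⟨by linarith [hs.1], hs.2.le⟩) hpos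
  obtain ⟨Δ₂, hΔ₂⟩ := exists_isLeastStep (S := Set.Ioo (-1) 0) hfin
    (fun s hs => abs_le.2 ⟨hs.1.le, by linarith [hs.2]⟩) hneg
  have hle := one_le_sub_of_isLeastStep hf hΔ₁ hΔ₂
  have hcons := fun x y => eq_of_areConsecutive_cutAndProject (x := x) (y := y) (t := t) hf hg
    hΔ₁ hΔ₂ hJ
  rw [← hX] at hcons
  obtain ⟨p1, ⟨q1, r1⟩, m1⟩ := hΔ₁
  obtain ⟨p2, ⟨q2, r2⟩, m2⟩ := hΔ₂
  have hmem : ∀ z, g z - t ∈ J → f z ∈ X := fun z hz => by rw [hX]; exact ⟨z, rfl, hz⟩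
  have hmem' : ∀ x ∈ X, ∃ z, f z = x ∧ g z - t ∈ J := fun x hx => by rwa [hX] at hx
  have hJ01 : ∀ p, p ∈ J → 0 ≤ p ∧ p < 1 := by
    rcases hJ with rfl | rfl
    · exact fun p hp => hp
    · exact fun p hp => ⟨hp.1.le, hp.2⟩
  have hloc : ∀ a b : ℝ, (X ∩ Set.Icc a b).Finite := by
    intro a b
    refine ((hfin (max (|a| + |b|) (|t| + 1))).image f).subset ?_
    rintro x ⟨hx, hxa, hxb⟩
    obtain ⟨z, rfl, hz⟩ := hmem' x hx
    refine ⟨z, ⟨le_max_of_le_left (abs_le.2 ⟨?_, ?_⟩), le_max_of_le_right (abs_le.2 ⟨?_, ?_⟩)⟩,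
      rfl⟩
    · linarith [neg_abs_le a, abs_nonneg b]
    · linarith [le_abs_self b, abs_nonneg a]
    · linarith [neg_abs_le t, (hJ01 _ hz).1]
    · linarith [le_abs_self t, (hJ01 _ hz).2]
  have hmax : ∀ x ∈ X, ∃ y ∈ X, x < y := by
    intro x hx
    obtain ⟨z, rfl, hz⟩ := hmem' x hx
    by_cases hA : g z - t + g Δ₁ ∈ J
    · refine ⟨f (z + Δ₁), hmem _ ?_, ?_⟩
      · rwa [map_add, add_sub_right_comm]
      · rw [map_add]; linarith
    by_cases hC : g z - t + g Δ₂ ∈ J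
    · refine ⟨f (z + Δ₂), hmem _ ?_, ?_⟩
      · rwa [map_add, add_sub_right_comm]
      · rw [map_add]; linarith
    refine ⟨f (z + (Δ₁ + Δ₂)), hmem _ ?_, ?_⟩
    · rw [map_add, add_sub_right_comm, map_add]
      rcases hJ with rfl | rfl <;> simp only [Set.mem_Ico, Set.mem_Ioo] at * <;> grind
    · rw [map_add, map_add]; linarith
  have hmin : ∀ x ∈ X, ∃ y ∈ X, y < x := by
    intro x hx
    obtain ⟨z, rfl, hz⟩ := hmem' x hx
    by_cases hA : g z - t - g Δ₁ ∈ J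
    · refine ⟨f (z - Δ₁), hmem _ ?_, ?_⟩
      · rwa [map_sub, sub_right_comm]
      · rw [map_sub]; linarith
    by_cases hC : g z - t - g Δ₂ ∈ J
    · refine ⟨f (z - Δ₂), hmem _ ?_, ?_⟩
      · rwa [map_sub, sub_right_comm]
      · rw [map_sub]; linarith
    refine ⟨f (z - (Δ₁ + Δ₂)), hmem _ ?_, ?_⟩
    · rw [map_sub, sub_right_comm, map_add]
      rcases hJ with rfl | rfl <;> simp only [Set.mem_Ico, Set.mem_Ioo] at * <;> grind
    · rw [map_sub, map_add]; linarith
  obtain ⟨y, hy, hyX⟩ := exists_strictMono_int_range_eq hne hloc hmax hmin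
  refine ⟨f Δ₁, f Δ₂, p1, p2, fun h => by rw [hf h] at q1; linarith, ?_, y, hy, hyX,
    1 - g Δ₁, -g Δ₂, {x | x ∈ J ∧ x + g Δ₁ ∈ J}, {x | x ∈ J ∧ x + g Δ₁ ∉ J ∧ x + g Δ₂ ∉ J},
    {x | x ∈ J ∧ x + g Δ₂ ∈ J}, intervalExchange J hJ (g Δ₁) (g Δ₂) q1 r1 r2 q2 hle, ?_⟩
  · intro x y hxy
    obtain ⟨z, rfl, hz⟩ := hmem' x hxy.1
    obtain ⟨w, rfl, hw⟩ := hmem' y hxy.2.1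
    obtain ⟨h1, h2, h3⟩ := hcons z w hxy
    by_cases hA : g z - t + g Δ₁ ∈ J
    · rw [h1 hA]; simp
    by_cases hC : g z - t + g Δ₂ ∈ J
    · rw [h2 hC]; simp
    rw [h3 hA hC]; simp
  have hE := isThreeIntervalExchange_intervalExchange J hJ (g Δ₁) (g Δ₂) q1 r1 r2 q2 hle
  set T := intervalExchange J hJ (g Δ₁) (g Δ₂) q1 r1 r2 q2 hle with hT
  have hyn : ∀ n, ∃ z, f z = y n ∧ g z - t ∈ J := fun n => hmem' _ (hyX ▸ ⟨n, rfl⟩)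
  choose z hz hzJ using hyn
  have hstep : ∀ n, (g (z n) - t + g Δ₁ ∈ J → z (n + 1) = z n + Δ₁) ∧
      (g (z n) - t + g Δ₂ ∈ J → z (n + 1) = z n + Δ₂) ∧
      (g (z n) - t + g Δ₁ ∉ J → g (z n) - t + g Δ₂ ∉ J → z (n + 1) = z n + (Δ₁ + Δ₂)) := by
    intro n
    apply hcons
    rw [hz, hz]
    exact areConsecutive_of_strictMono hy hyX n
  -- The internal coordinate `g (z n) - t` of the `n`-th point is moved by `T` to that of the next
  -- one, so it runs through the orbit to be coded.
  have hTstep : ∀ n, T ⟨g (z n) - t, hzJ n⟩ = ⟨g (z (n + 1)) - t, hzJ (n + 1)⟩ := by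
    intro n
    apply Subtype.ext
    obtain ⟨h1, h2, h3⟩ := hstep n
    by_cases hA : g (z n) - t + g Δ₁ ∈ J
    · rw [hE.apply_A _ ⟨hzJ n, hA⟩]
      simp only [h1 hA, map_add]; ring
    by_cases hC : g (z n) - t + g Δ₂ ∈ J
    · rw [hE.apply_C _ ⟨hzJ n, hC⟩]
      simp only [h2 hC, map_add]; ring
    rw [hE.apply_B _ ⟨hzJ n, hA, hC⟩]
    simp only [h3 hA hC, map_add]; ring
  have hTpow : ∀ n : ℤ, (T ^ n) ⟨g (z 0) - t, hzJ 0⟩ = ⟨g (z n) - t, hzJ n⟩ := by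
    intro n
    induction n using Int.induction_on with
    | zero => simp
    | succ k ih => rw [add_comm, zpow_add, zpow_one, Equiv.Perm.mul_apply, ih, hTstep, add_comm]
    | pred k ih =>
      rw [sub_eq_add_neg, add_comm, zpow_add, Equiv.Perm.mul_apply, ih, zpow_neg_one,
        Equiv.Perm.inv_eq_iff_eq, hTstep]
      simp only [neg_add_cancel_comm]
  refine ⟨⟨g (z 0) - t, hzJ 0⟩, hE, ?_, ?_⟩
  · intro n
    obtain ⟨h1, h2, h3⟩ := hstep n
    rw [hTpow]
    dsimp only
    refine ⟨fun h => ?_, fun h => ?_, fun h => ?_⟩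
    · rw [← hz, ← hz, h1 h.2, map_add]; ring
    · rw [← hz, ← hz, h3 h.2.1 h.2.2, map_add, map_add]; ring
    · rw [← hz, ← hz, h2 h.2, map_add]; ring
  · rintro rfl
    exact areLeftClosedRightOpen_Ico q1 r1 q2 hle

end CutAndProject

/-! ### Recursive structure of the spectrum. -/

section DigitSpectrum

variable {A : Finset ℤ} {α : ℝ}

theorem digit_add_mul_mem_digitSpectrum {a : ℤ} {x : ℝ} (ha : a ∈ A)
    (hx : x ∈ digitSpectrum A α) : (a : ℝ) + α * x ∈ digitSpectrum A α := by
  obtain ⟨n, d, hd, rfl⟩ := hx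
  refine ⟨n + 1, fun j => Nat.casesOn j a d, ?_, ?_⟩
  · rintro (_ | j)
    · exact ha
    · exact hd j
  · rw [Finset.sum_range_succ' _ (n + 1), Finset.mul_sum, add_comm]
    simp only [pow_zero, mul_one]
    congr 1
    refine Finset.sum_congr rfl fun j _ => ?_
    ring

theorem intCast_mem_digitSpectrum {a : ℤ} (ha : a ∈ A) : (a : ℝ) ∈ digitSpectrum A α :=
  ⟨0, fun _ => a, fun _ => ha, by simp⟩

theorem zero_mem_digitSpectrum (h0 : (0 : ℤ) ∈ A) : (0 : ℝ) ∈ digitSpectrum A α := by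
  exact_mod_cast intCast_mem_digitSpectrum (α := α) h0

theorem digitSpectrum_mono {A B : Finset ℤ} (h : A ⊆ B) :
    digitSpectrum A α ⊆ digitSpectrum B α := by
  rintro x ⟨n, d, hd, rfl⟩
  exact ⟨n, d, fun j => h (hd j), rfl⟩

/-- Horner's scheme: the constant digit is split off, down to the empty sum. -/
theorem digitSpectrum_induction {p : ℝ → Prop} (h0 : p 0)
    (hstep : ∀ a ∈ A, ∀ x, p x → p ((a : ℝ) + α * x)) : ∀ x ∈ digitSpectrum A α, p x := by
  have key : ∀ (n : ℕ) (d : ℕ → ℤ), (∀ j, d j ∈ A) →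
      p (∑ j ∈ Finset.range n, (d j : ℝ) * α ^ j) := by
    intro n
    induction n with
    | zero => intro d _; simpa using h0
    | succ n ih =>
      intro d hd
      convert hstep (d 0) (hd 0) _ (ih (fun j => d (j + 1)) fun j => hd _) using 1
      rw [Finset.sum_range_succ', Finset.mul_sum, add_comm]
      simp only [pow_zero, mul_one]
      congr 1
      refine Finset.sum_congr rfl fun j _ => ?_
      ring
  rintro x ⟨n, d, hd, rfl⟩
  exact key (n + 1) d hd

end DigitSpectrum

/-! ### Arithmetic of `ℤ[α]` and conjugation. -/

/-- The evaluation of `u + v X` at `x`. -/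
def linEval (x : ℝ) : ℤ × ℤ →+ ℝ where
  toFun z := z.1 + z.2 * x
  map_zero' := by simp
  map_add' z w := by simp only [Prod.fst_add, Prod.snd_add]; push_cast; ring

theorem linEval_apply (x : ℝ) (z : ℤ × ℤ) : linEval x z = z.1 + z.2 * x := rfl

/-- `α` is a quadratic unit of modulus larger than `1`, with the conjugate `α'`, the trace `M` and
the norm `ε`. -/
structure IsConjugateUnitPair (α α' : ℝ) (M ε : ℤ) : Prop where
  irrational : Irrational α
  add_eq : α + α' = M
  mul_eq : α * α' = ε
  norm_eq : ε = 1 ∨ ε = -1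
  one_lt_abs : 1 < |α|

namespace IsConjugateUnitPair

variable {α α' : ℝ} {M ε : ℤ}

theorem sq_norm (h : IsConjugateUnitPair α α' M ε) : (ε : ℝ) * ε = 1 := by
  rcases h.norm_eq with rfl | rfl <;> norm_num

theorem abs_mul_abs (h : IsConjugateUnitPair α α' M ε) : |α| * |α'| = 1 := by
  rw [← abs_mul, h.mul_eq]
  rcases h.norm_eq with rfl | rfl <;> norm_num

theorem ne_zero (h : IsConjugateUnitPair α α' M ε) : α ≠ 0 := by
  rintro rfl
  simpa using h.abs_mul_abs

theorem ne_zero' (h : IsConjugateUnitPair α α' M ε) : α' ≠ 0 := by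
  rintro rfl
  simpa using h.abs_mul_abs

theorem abs_lt_one (h : IsConjugateUnitPair α α' M ε) : |α'| < 1 := by
  nlinarith [h.abs_mul_abs, h.one_lt_abs, abs_nonneg α']

theorem ne (h : IsConjugateUnitPair α α' M ε) : α ≠ α' := by
  intro he
  have := h.abs_lt_one
  rw [← he] at this
  exact lt_asymm this h.one_lt_abs

theorem irrational' (h : IsConjugateUnitPair α α' M ε) : Irrational α' := by
  rw [← sub_eq_of_eq_add' h.add_eq.symm]
  exact h.irrational.intCast_sub M

theorem linEval_injective_of_irrational {x : ℝ} (hx : Irrational x) :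
    Function.Injective (linEval x) := by
  rw [injective_iff_map_eq_zero]
  rintro ⟨u, v⟩ huv
  rw [linEval_apply] at huv
  dsimp only at huv
  by_cases hv : v = 0
  · subst hv
    simp only [Int.cast_zero, zero_mul, add_zero, Int.cast_eq_zero] at huv
    rw [huv]; rfl
  · exact absurd huv ((hx.intCast_mul hv).intCast_add u).ne_zero

/-- Multiplication by `α` in `ℤ[α]`. -/
theorem exists_linEval_mul (h : IsConjugateUnitPair α α' M ε) (z : ℤ × ℤ) :
    ∃ w, linEval α w = α * linEval α z ∧ linEval α' w = α' * linEval α' z := by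
  -- From `α² = M α - ε`, which `α'` satisfies as well.
  refine ⟨(-ε * z.2, z.1 + M * z.2), ?_, ?_⟩ <;> simp only [linEval_apply] <;> push_cast <;>
    rw [← h.mul_eq, ← h.add_eq] <;> ring

/-- Division by `α` in `ℤ[α]`. -/
theorem exists_mul_linEval (h : IsConjugateUnitPair α α' M ε) (z : ℤ × ℤ) :
    ∃ w, linEval α z = α * linEval α w ∧ linEval α' z = α' * linEval α' w := by
  have hε := h.sq_norm
  -- From `α⁻¹ = ε (M - α)`, where `ε² = 1`.
  refine ⟨(z.2 + ε * M * z.1, -ε * z.1), ?_, ?_⟩ <;> simp only [linEval_apply] <;> push_cast <;>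
    rw [← h.add_eq] <;> linear_combination (-(ε : ℝ) * z.1) * h.mul_eq - z.1 * hε

theorem exists_linEval_eq_of_mem (h : IsConjugateUnitPair α α' M ε) {A : Finset ℤ} {x : ℝ}
    (hx : x ∈ digitSpectrum A α) (h0 : (0 : ℤ) ∈ A) :
    ∃ z, linEval α z = x ∧ linEval α' z ∈ digitSpectrum A α' := by
  revert x
  apply digitSpectrum_induction
  · exact ⟨0, map_zero _, by rw [map_zero]; exact zero_mem_digitSpectrum h0⟩
  · rintro a ha x ⟨z, rfl, hz⟩
    obtain ⟨w, hw, hw'⟩ := h.exists_linEval_mul z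
    refine ⟨(a, 0) + w, ?_, ?_⟩
    · rw [map_add, hw, linEval_apply]; simp
    · rw [map_add, hw', linEval_apply]
      simpa using digit_add_mul_mem_digitSpectrum ha hz

theorem exists_linEval_eq_of_mem' (h : IsConjugateUnitPair α α' M ε) {A : Finset ℤ} {x : ℝ}
    (hx : x ∈ digitSpectrum A α') (h0 : (0 : ℤ) ∈ A) :
    ∃ z, linEval α' z = x ∧ linEval α z ∈ digitSpectrum A α := by
  revert x
  apply digitSpectrum_induction
  · exact ⟨0, map_zero _, by rw [map_zero]; exact zero_mem_digitSpectrum h0⟩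
  · rintro a ha x ⟨z, rfl, hz⟩
    obtain ⟨w, hw, hw'⟩ := h.exists_linEval_mul z
    refine ⟨(a, 0) + w, ?_, ?_⟩
    · rw [map_add, hw', linEval_apply]; simp
    · rw [map_add, hw, linEval_apply]
      simpa using digit_add_mul_mem_digitSpectrum ha hz

theorem linEval_mem_iff (h : IsConjugateUnitPair α α' M ε) {A : Finset ℤ} (h0 : (0 : ℤ) ∈ A)
    (z : ℤ × ℤ) : linEval α z ∈ digitSpectrum A α ↔ linEval α' z ∈ digitSpectrum A α' := by
  constructor
  · intro hz
    obtain ⟨w, hw, hw'⟩ := h.exists_linEval_eq_of_mem hz h0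
    rwa [← linEval_injective_of_irrational h.irrational hw]
  · intro hz
    obtain ⟨w, hw, hw'⟩ := h.exists_linEval_eq_of_mem' hz h0
    rwa [← linEval_injective_of_irrational h.irrational' hw]

/-- Both embeddings together are an invertible linear map of `(u, v)`: their difference is `v (α -
α')`, which bounds `v` and then `u`. -/
theorem finite_bounded (h : IsConjugateUnitPair α α' M ε) (C : ℝ) :
    {z | |linEval α z| ≤ C ∧ |linEval α' z| ≤ C}.Finite := by
  have hd : 0 < |α - α'| := abs_pos.2 (sub_ne_zero.2 h.ne)
  set V : ℝ := 2 * C / |α - α'| with hV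
  refine ((Set.finite_Icc (-⌈C + V * |α|⌉) ⌈C + V * |α|⌉).prod
    (Set.finite_Icc (-⌈V⌉) ⌈V⌉)).subset ?_
  rintro ⟨u, v⟩ ⟨h1, h2⟩
  rw [linEval_apply] at h1 h2
  dsimp only at h1 h2
  have hv : |(v : ℝ)| ≤ V := by
    rw [hV, le_div_iff₀ hd, ← abs_mul]
    have : (v : ℝ) * (α - α') = (u + v * α) - (u + v * α') := by ring
    rw [this]
    linarith [abs_sub (u + v * α) (u + v * α')]
  have hu : |(u : ℝ)| ≤ C + V * |α| := by
    have : (u : ℝ) = (u + v * α) - v * α := by ring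
    rw [this]
    have h3 := abs_sub (u + v * α) (v * α)
    have h4 : |(v : ℝ) * α| ≤ V * |α| := by
      rw [abs_mul]; exact mul_le_mul_of_nonneg_right hv (abs_nonneg _)
    linarith
  rw [abs_le] at hu hv
  have e1 := Int.le_ceil (C + V * |α|)
  have e2 := Int.le_ceil V
  refine ⟨⟨?_, ?_⟩, ⟨?_, ?_⟩⟩
  · have : (-⌈C + V * |α|⌉ : ℝ) ≤ u := by linarith
    exact_mod_cast this
  · have : (u : ℝ) ≤ ⌈C + V * |α|⌉ := by linarith
    exact_mod_cast this
  · have : (-⌈V⌉ : ℝ) ≤ v := by linarith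
    exact_mod_cast this
  · have : (v : ℝ) ≤ ⌈V⌉ := by linarith
    exact_mod_cast this

end IsConjugateUnitPair

/-! ### Division with digits inside the window. -/

/-- Integer translates of an interval of length larger than `1` cover an interval. -/
theorem exists_digit_abs_sub_lt {a b : ℤ} {c r x : ℝ} (hab : a ≤ b) (hr : 1 < 2 * r)
    (hx : |x - ((a + b) / 2 + c)| < (b - a) / 2 + r) :
    ∃ k ∈ Finset.Icc a b, |x - k - c| < r := by
  rw [abs_lt] at hx
  have h1 := Int.floor_le (x - c - r)
  have h2 := Int.lt_floor_add_one (x - c - r)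
  rcases le_or_gt a (⌊x - c - r⌋ + 1) with h | h
  · refine ⟨⌊x - c - r⌋ + 1, Finset.mem_Icc.2 ⟨h, ?_⟩, ?_⟩
    · have : ⌊x - c - r⌋ < b := Int.floor_lt.2 (by linarith)
      omega
    · rw [abs_lt]; push_cast; constructor <;> linarith
  · refine ⟨a, Finset.mem_Icc.2 ⟨le_rfl, hab⟩, ?_⟩
    have : ((⌊x - c - r⌋ + 1 : ℤ) : ℝ) < a := by exact_mod_cast h
    push_cast at this
    rw [abs_lt]; constructor <;> linarith

namespace IsConjugateUnitPair

variable {α α' : ℝ} {M ε : ℤ}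

theorem exists_digit_step (h : IsConjugateUnitPair α α' M ε) {a b : ℤ} (hab : a ≤ b) {s r : ℝ}
    (hr : 1 < 2 * (|α'| * r)) {z : ℤ × ℤ}
    (hz : |linEval α' z - ((a + b) / 2 + α' * s)| < (b - a) / 2 + |α'| * r) :
    ∃ k ∈ Finset.Icc a b, ∃ w, linEval α z = k + α * linEval α w ∧ |linEval α' w - s| < r := by
  obtain ⟨k, hk, hk'⟩ := exists_digit_abs_sub_lt hab hr hz
  obtain ⟨w, hw, hw'⟩ := h.exists_mul_linEval (z - (k, 0))
  rw [map_sub] at hw hw'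
  simp only [linEval_apply _ (k, 0), Int.cast_zero, zero_mul, add_zero] at hw hw'
  refine ⟨k, hk, w, by linarith, ?_⟩
  rw [hw', ← mul_sub, abs_mul] at hk'
  exact lt_of_mul_lt_mul_left hk' (abs_nonneg _)

/-- If all points of `ℤ[α]` with conjugate in a long enough interval belong to the spectrum, then
so do all those with conjugate in the interior of the full window. -/
theorem mem_digitSpectrum_of_subwindow (h : IsConjugateUnitPair α α' M ε) {a b : ℤ} (hab : a ≤ b)
    {s₀ r₀ s r : ℝ} (hr₀ : 1 < 2 * (|α'| * r₀)) (hr : r₀ ≤ r)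
    (hs : s = (a + b) / 2 + α' * s) (hr' : r = (b - a) / 2 + |α'| * r)
    (h₀ : ∀ z, |linEval α' z - s₀| < r₀ → linEval α z ∈ digitSpectrum (Finset.Icc a b) α)
    (z : ℤ × ℤ) (hz : |linEval α' z - s| < r) :
    linEval α z ∈ digitSpectrum (Finset.Icc a b) α := by
  -- The window reached after `k` digits has centre and radius given by the `k`-th iterates of `x ↦
  -- (a + b) / 2 + α' x` and `x ↦ (b - a) / 2 + |α'| x`, started at `s₀` and `r₀`; these tend to `s`
  -- and `r`.
  have key : ∀ (k : ℕ) (z : ℤ × ℤ), |linEval α' z - (s + α' ^ k * (s₀ - s))| <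
      r + |α'| ^ k * (r₀ - r) → linEval α z ∈ digitSpectrum (Finset.Icc a b) α := by
    intro k
    induction k with
    | zero => intro z hz; exact h₀ z (by simpa using hz)
    | succ k ih =>
      intro z hz
      have h1 : r₀ ≤ r + |α'| ^ k * (r₀ - r) := by
        have := pow_le_one₀ (n := k) (abs_nonneg α') h.abs_lt_one.le
        nlinarith
      obtain ⟨d, hd, w, hw, hw'⟩ := h.exists_digit_step hab (s := s + α' ^ k * (s₀ - s))
        (r := r + |α'| ^ k * (r₀ - r)) (z := z)
        (by nlinarith [mul_le_mul_of_nonneg_left h1 (abs_nonneg α')]) (by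
          rw [show ((a : ℝ) + b) / 2 + α' * (s + α' ^ k * (s₀ - s)) = s + α' ^ (k + 1) * (s₀ - s) by
              rw [pow_succ]; linear_combination -hs,
            show ((b : ℝ) - a) / 2 + |α'| * (r + |α'| ^ k * (r₀ - r)) =
              r + |α'| ^ (k + 1) * (r₀ - r) by rw [pow_succ]; linear_combination -hr']
          exact hz)
      rw [hw]
      exact digit_add_mul_mem_digitSpectrum hd (ih w hw')
  have hlim : Filter.Tendsto (fun k : ℕ => r + |α'| ^ k * (r₀ - r) -
      |linEval α' z - (s + α' ^ k * (s₀ - s))|) Filter.atTop (nhds (r + 0 * (r₀ - r) -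
      |linEval α' z - (s + 0 * (s₀ - s))|)) := by
    have e1 := tendsto_pow_atTop_nhds_zero_of_lt_one (abs_nonneg α') h.abs_lt_one
    have e2 := tendsto_pow_atTop_nhds_zero_of_abs_lt_one h.abs_lt_one
    exact ((e1.mul_const _).const_add _).sub
      (((e2.mul_const _).const_add _).const_sub _).abs
  obtain ⟨k, hk⟩ := (hlim.eventually_const_lt (u := 0) (by simpa using hz)).exists
  exact key k z (by linarith)

/-- To see that all points of `ℤ[α]` with conjugate in the interior of the window belong to the
spectrum, it suffices to consider those in the attractor of the division by `α`. -/
theorem mem_digitSpectrum_of_attractor (h : IsConjugateUnitPair α α' M ε) {a b : ℤ} (hab : a ≤ b)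
    {s r c : ℝ} (hr₀ : 1 < 2 * (|α'| * r))
    (hs : s = (a + b) / 2 + α' * s) (hr : r = (b - a) / 2 + |α'| * r)
    (hc : c = (a + b) / 2 + α * c)
    (hatt : ∀ z, (|α| - 1) * |linEval α z - c| ≤ (b - a) / 2 → |linEval α' z - s| < r →
      linEval α z ∈ digitSpectrum (Finset.Icc a b) α)
    (z : ℤ × ℤ) (hz : |linEval α' z - s| < r) :
    linEval α z ∈ digitSpectrum (Finset.Icc a b) α := by
  by_contra hbad
  have hF : {w | |linEval α w - c| ≤ |linEval α z - c| ∧ |linEval α' w - s| < r ∧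
      linEval α w ∉ digitSpectrum (Finset.Icc a b) α}.Finite := by
    refine (h.finite_bounded (max (|linEval α z - c| + |c|) (r + |s|))).subset ?_
    rintro w ⟨h1, h2, -⟩
    constructor
    · refine le_max_of_le_left ?_
      have := abs_add_le (linEval α w - c) c
      rw [sub_add_cancel] at this
      linarith
    · refine le_max_of_le_right ?_
      have := abs_add_le (linEval α' w - s) s
      rw [sub_add_cancel] at this
      linarith
  -- A counterexample `w` closest to `c`. Its quotient `y` is again a counterexample, hence no
  -- closer, while division by `α` brings it closer unless `w` is in the attractor.
  obtain ⟨w, ⟨h1, h2, h3⟩, hmin⟩ := Set.exists_min_image _ (fun w => |linEval α w - c|) hF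
    ⟨z, le_rfl, hz, hbad⟩
  apply h3
  apply hatt w _ h2
  obtain ⟨d, hd, y, hy, hy'⟩ := h.exists_digit_step hab hr₀ (z := w) (by rwa [← hs, ← hr])
  have hy3 : linEval α y ∉ digitSpectrum (Finset.Icc a b) α := fun hmem =>
    h3 (by rw [hy]; exact digit_add_mul_mem_digitSpectrum hd hmem)
  have hle : |linEval α w - c| ≤ |linEval α y - c| := by
    rcases le_total |linEval α y - c| |linEval α z - c| with h4 | h4
    · exact hmin y ⟨h4, hy', hy3⟩
    · exact h1.trans h4
  have hmul : |α| * |linEval α y - c| ≤ |linEval α w - c| + (b - a) / 2 := by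
    rw [← abs_mul]
    have e : α * (linEval α y - c) = (linEval α w - c) - (d - (a + b) / 2) := by
      linear_combination -hy + hc
    rw [e]
    refine (abs_sub _ _).trans (add_le_add_right ?_ _)
    rw [Finset.mem_Icc] at hd
    have hd1 : (a : ℝ) ≤ d := by exact_mod_cast hd.1
    have hd2 : (d : ℝ) ≤ b := by exact_mod_cast hd.2
    rw [abs_le]; constructor <;> linarith
  have := mul_le_mul_of_nonneg_left hle (abs_nonneg α)
  linarith

end IsConjugateUnitPair

/-! ### Filling the window: reduction to small alphabets and to the attractor. -/

/-- All points of `ℤ[α]` with conjugate in the interior of the window `[s - r, s + r]` belong to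
the spectrum with the digits `a, …, b`. -/
def FillsWindow (α α' : ℝ) (a b : ℤ) : Prop :=
  ∀ s r : ℝ, s = (a + b) / 2 + α' * s → r = (b - a) / 2 + |α'| * r →
    ∀ z, |linEval α' z - s| < r → linEval α z ∈ digitSpectrum (Finset.Icc a b) α

namespace IsConjugateUnitPair

variable {α α' : ℝ} {M ε : ℤ}

/-- Since `2 |α'| r = (b - a) / (|α| - 1)`, the number of digits exceeds `|α|` exactly when
neighbouring images of the window overlap. -/
theorem one_lt_two_mul_abs_mul (h : IsConjugateUnitPair α α' M ε) {a b : ℤ} {r : ℝ}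
    (hab : |α| < b - a + 1) (hr : r = (b - a) / 2 + |α'| * r) : 1 < 2 * (|α'| * r) := by
  have h1 : (|α| - 1) * (|α'| * r) = (b - a) / 2 := by
    linear_combination hr + r * h.abs_mul_abs
  have h2 := h.one_lt_abs
  by_contra! hle
  nlinarith

/-- The filled window of the smaller alphabet is a starting window for the larger one. This permits
passing to a minimal alphabet, whose attractor is small enough for an explicit enumeration. -/
theorem fillsWindow_of_le (h : IsConjugateUnitPair α α' M ε) {a b a₀ b₀ : ℤ} (ha : a ≤ a₀)
    (hb : b₀ ≤ b) (hab : a₀ ≤ b₀) (hcard : |α| < b₀ - a₀ + 1) (h₀ : FillsWindow α α' a₀ b₀) :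
    FillsWindow α α' a b := by
  intro s r hs hr
  have h1 : 0 < 1 - |α'| := by linarith [h.abs_lt_one]
  have h1' : 0 < 1 - α' := by linarith [le_abs_self α']
  obtain ⟨s₀, hs₀⟩ : ∃ s₀ : ℝ, s₀ = (a₀ + b₀) / 2 + α' * s₀ :=
    ⟨(a₀ + b₀) / 2 / (1 - α'), by field_simp; ring⟩
  obtain ⟨r₀, hr₀⟩ : ∃ r₀ : ℝ, r₀ = (b₀ - a₀) / 2 + |α'| * r₀ :=
    ⟨(b₀ - a₀) / 2 / (1 - |α'|), by field_simp; ring⟩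
  have ha' : (a : ℝ) ≤ a₀ := by exact_mod_cast ha
  have hb' : (b₀ : ℝ) ≤ b := by exact_mod_cast hb
  refine h.mem_digitSpectrum_of_subwindow (ha.trans (hab.trans hb)) (s₀ := s₀)
    (h.one_lt_two_mul_abs_mul hcard hr₀) ?_ hs hr fun z hz => ?_
  · by_contra! hlt
    nlinarith
  · exact digitSpectrum_mono (Finset.Icc_subset_Icc ha hb) (h₀ s₀ r₀ hs₀ hr₀ z hz)

theorem fillsWindow_of_attractor (h : IsConjugateUnitPair α α' M ε) {a b : ℤ} (hab : a ≤ b)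
    (hcard : |α| < b - a + 1)
    (hatt : ∀ s r c : ℝ, s = (a + b) / 2 + α' * s → r = (b - a) / 2 + |α'| * r →
      c = (a + b) / 2 + α * c → ∀ u v : ℤ, (|α| - 1) * |(u + v * α) - c| ≤ (b - a) / 2 →
      |(u + v * α') - s| < r → (u + v * α) ∈ digitSpectrum (Finset.Icc a b) α) :
    FillsWindow α α' a b := by
  intro s r hs hr
  have h1 : 1 - α ≠ 0 := by
    intro h1
    have := h.one_lt_abs
    rw [← sub_eq_zero.1 h1] at this
    simp at this
  exact h.mem_digitSpectrum_of_attractor hab (h.one_lt_two_mul_abs_mul hcard hr) hs hr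
    (c := (a + b) / 2 / (1 - α)) (by field_simp; ring)
    fun z => hatt s r _ hs hr (by field_simp; ring) z.1 z.2

end IsConjugateUnitPair

theorem Int.lt_of_cast_mul_lt {v k : ℤ} {P : ℝ} (hP : 0 < P) (h : (v : ℝ) * P < k * P) : v < k := by
  have : (v : ℝ) < k := _root_.lt_of_mul_lt_mul_right h hP.le
  exact_mod_cast this

/-! ### Enumeration of the attractor, by the signs of `α` and `α'`. -/

section Attractor

variable {β δ : ℝ} {a b m : ℤ}

theorem window_pos {s r z : ℝ} (hδ : 0 < δ) (hδ' : δ < 1) (hs : s = (a + b) / 2 + δ * s)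
    (hr : r = (b - a) / 2 + |δ| * r) (hz : |z - s| < r) :
    a < (1 - δ) * z ∧ (1 - δ) * z < b := by
  rw [abs_of_pos hδ] at hr
  have hz2 : |(1 - δ) * (z - s)| < (1 - δ) * r := by
    rw [abs_mul, abs_of_pos (by linarith : 0 < 1 - δ)]
    exact mul_lt_mul_of_pos_left hz (by linarith)
  rw [abs_lt] at hz2
  constructor <;> linarith

theorem window_neg {s r z : ℝ} (hδ : 0 < δ) (hδ' : δ < 1) (hs : s = (a + b) / 2 + -δ * s)
    (hr : r = (b - a) / 2 + |-δ| * r) (hz : |z - s| < r) :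
    a - b * δ < (1 - δ ^ 2) * z ∧ (1 - δ ^ 2) * z < b - a * δ := by
  rw [abs_neg, abs_of_pos hδ] at hr
  have hδ2 : 0 < 1 - δ ^ 2 := by nlinarith
  have hz2 : |(1 - δ ^ 2) * (z - s)| < (1 - δ ^ 2) * r := by
    rw [abs_mul, abs_of_pos hδ2]
    exact mul_lt_mul_of_pos_left hz hδ2
  rw [abs_lt] at hz2
  have e1 : (1 - δ ^ 2) * s = (1 - δ) * ((a + b) / 2) := by linear_combination (1 - δ) * hs
  have e2 : (1 - δ ^ 2) * r = (1 + δ) * ((b - a) / 2) := by linear_combination (1 + δ) * hr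
  constructor <;> linarith

theorem attractor_pos {c z : ℝ} (hβ : 1 < β) (hc : c = (a + b) / 2 + β * c)
    (hz : (|β| - 1) * |z - c| ≤ (b - a) / 2) :
    -b ≤ (β - 1) * z ∧ (β - 1) * z ≤ -a := by
  rw [abs_of_pos (by linarith : 0 < β), ← abs_of_pos (by linarith : 0 < β - 1), ← abs_mul,
    abs_le] at hz
  constructor <;> linarith

theorem attractor_neg {c z : ℝ} (hβ : 1 < β) (hc : c = (a + b) / 2 + -β * c)
    (hz : (|-β| - 1) * |z - c| ≤ (b - a) / 2) :
    a * β - b ≤ (β ^ 2 - 1) * z ∧ (β ^ 2 - 1) * z ≤ b * β - a := by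
  rw [abs_neg, abs_of_pos (by linarith : 0 < β)] at hz
  have hβ2 : 0 < β ^ 2 - 1 := by nlinarith
  have hz2 : |(β ^ 2 - 1) * (z - c)| ≤ (β + 1) * ((b - a) / 2) := by
    rw [abs_mul, abs_of_pos hβ2, show β ^ 2 - 1 = (β + 1) * (β - 1) by ring, mul_assoc]
    exact mul_le_mul_of_nonneg_left hz (by linarith)
  rw [abs_le] at hz2
  have e1 : (β ^ 2 - 1) * c = (β - 1) * ((a + b) / 2) := by linear_combination (β - 1) * hc
  constructor <;> linarith

/-- Eliminating `u` bounds `v (β - δ) (β - 1)` strictly by `-a (1 + β)` from above and by `-b (1 +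
β)` from below. Digits of both signs give `-a, b ≤ m - 2`, and `(m - 2) (1 + β)` equals `(β - δ) (β
- 1)`: the open window just excludes `v = ±1`. -/
theorem eq_zero_of_bounds_pos_pos (hβ : 1 < β) (hδ : 0 < δ) (hβδ : β * δ = 1)
    (hm : β + δ = m) (ha : a ≤ -1) (hb : 1 ≤ b) (hab : b - a = m - 1) {u v : ℤ}
    (h1 : -b ≤ (β - 1) * (u + v * β)) (h2 : (β - 1) * (u + v * β) ≤ -a)
    (h3 : a < (1 - δ) * (u + v * δ)) (h4 : (1 - δ) * (u + v * δ) < b) : u = 0 ∧ v = 0 := by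
  have ha' : (a : ℝ) ≤ -1 := by exact_mod_cast ha
  have hb' : (1 : ℝ) ≤ b := by exact_mod_cast hb
  have hab' : (b : ℝ) - a = β + δ - 1 := by rw [hm]; exact_mod_cast hab
  have hδ1 : δ < 1 := by nlinarith
  have hP : 0 < (β - δ) * (β - 1) := mul_pos (by linarith) (by linarith)
  have h3' : a * β < (β - 1) * (u + v * δ) := by
    have := mul_lt_mul_of_pos_right h3 (by linarith : 0 < β)
    linear_combination this - (u + v * δ) * hβδ
  have h4' : (β - 1) * (u + v * δ) < b * β := by
    have := mul_lt_mul_of_pos_right h4 (by linarith : 0 < β)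
    linear_combination this + (u + v * δ) * hβδ
  have hv1 : v < 1 := by
    apply Int.lt_of_cast_mul_lt hP
    push_cast
    nlinarith
  have hv2 : -1 < v := by
    apply Int.lt_of_cast_mul_lt hP
    push_cast
    nlinarith
  obtain rfl : v = 0 := by omega
  simp only [Int.cast_zero, zero_mul, add_zero] at h1 h2
  have hu1 : u < 1 := by
    apply Int.lt_of_cast_mul_lt (P := β - 1) (by linarith)
    push_cast
    linarith
  have hu2 : -1 < u := by
    apply Int.lt_of_cast_mul_lt (P := β - 1) (by linarith)
    push_cast
    linarith
  exact ⟨by omega, rfl⟩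

theorem eq_zero_of_bounds_pos_neg (hβ : 1 < β) (hδ : 0 < δ) (hβδ : β * δ = 1)
    (hm : β - δ = m) (ha : a ≤ -1) (hb : 1 ≤ b) (hab : b - a = m) {u v : ℤ}
    (h1 : -b ≤ (β - 1) * (u + v * β)) (h2 : (β - 1) * (u + v * β) ≤ -a)
    (h3 : a - b * δ < (1 - δ ^ 2) * (u + v * -δ))
    (h4 : (1 - δ ^ 2) * (u + v * -δ) < b - a * δ) : u = 0 ∧ v = 0 := by
  have ha' : (a : ℝ) ≤ -1 := by exact_mod_cast ha
  have hb' : (1 : ℝ) ≤ b := by exact_mod_cast hb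
  have hab' : (b : ℝ) - a = β - δ := by rw [hm]; exact_mod_cast hab
  have hδ1 : δ < 1 := by nlinarith
  have hP : 0 < (β + δ) * (β ^ 2 - 1) := mul_pos (by linarith) (by nlinarith)
  -- The coefficient of `v` after eliminating `u`, rewritten with the factor `β - δ = m` so that it
  -- compares with the bounds on the digits.
  have hPm : (β + δ) * (β ^ 2 - 1) = (β - δ) * (β ^ 2 + 1) := by
    linear_combination (2 * β) * hβδ
  have hβ2 : 0 < β ^ 2 := by positivity
  have h3' : a * β ^ 2 - b * β < (β ^ 2 - 1) * (u + v * -δ) := by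
    have := mul_lt_mul_of_pos_right h3 hβ2
    linear_combination this - ((u + v * -δ) * (β * δ + 1) - b * β) * hβδ
  have h4' : (β ^ 2 - 1) * (u + v * -δ) < b * β ^ 2 - a * β := by
    have := mul_lt_mul_of_pos_right h4 hβ2
    linear_combination this + ((u + v * -δ) * (β * δ + 1) - a * β) * hβδ
  have h1' := mul_le_mul_of_nonneg_right h1 (by linarith : 0 ≤ β + 1)
  have h2' := mul_le_mul_of_nonneg_right h2 (by linarith : 0 ≤ β + 1)
  have e : (b - a) * β = β ^ 2 - 1 := by rw [hab']; linear_combination -hβδ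
  have hv1 : v < 1 := by
    apply Int.lt_of_cast_mul_lt hP
    have q : -a * (1 + β ^ 2) ≤ (β - δ - 1) * (1 + β ^ 2) :=
      mul_le_mul_of_nonneg_right (by linarith) (by linarith)
    have e' : v * ((β + δ) * (β ^ 2 - 1)) < (b - a) * β - a * (1 + β ^ 2) := by
      linear_combination h2' + h3'
    push_cast
    linarith
  have hv2 : -1 < v := by
    apply Int.lt_of_cast_mul_lt hP
    have q : b * (1 + β ^ 2) ≤ (β - δ - 1) * (1 + β ^ 2) :=
      mul_le_mul_of_nonneg_right (by linarith) (by linarith)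
    have e' : -((b - a) * β + b * (1 + β ^ 2)) < v * ((β + δ) * (β ^ 2 - 1)) := by
      linear_combination h1' + h4'
    push_cast
    linarith
  obtain rfl : v = 0 := by omega
  simp only [Int.cast_zero, zero_mul, add_zero] at h1 h2
  have hu1 : u < 1 := by
    apply Int.lt_of_cast_mul_lt (P := β - 1) (by linarith)
    push_cast
    linarith
  have hu2 : -1 < u := by
    apply Int.lt_of_cast_mul_lt (P := β - 1) (by linarith)
    push_cast
    linarith
  exact ⟨by omega, rfl⟩

/-- The golden ratio is exceptional: two digits would exceed `β`, but a positive base needs `-1`,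
`0` and `1`, and the attractor of three digits contains more than `0`. -/
theorem cases_of_bounds_golden (hβ : 1 < β) (hδ : 0 < δ) (hβδ : β * δ = 1)
    (hm : β - δ = 1) {u v : ℤ}
    (h1 : -1 ≤ (β - 1) * (u + v * β)) (h2 : (β - 1) * (u + v * β) ≤ 1)
    (h3 : -1 - δ < (1 - δ ^ 2) * (u + v * -δ))
    (h4 : (1 - δ ^ 2) * (u + v * -δ) < 1 + δ) :
    u ∈ Finset.Icc (-1) 1 ∧ v ∈ Finset.Icc (-1) 1 := by
  obtain rfl : δ = β - 1 := by linarith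
  have e : β ^ 2 = β + 1 := by linarith
  have hβ2 : 0 < β ^ 2 := by positivity
  have h1' : -β ≤ u + v * β := by nlinarith
  have h2' : u + v * β ≤ β := by nlinarith
  have h3' : -(β + 1) < u + v * -(β - 1) := by nlinarith
  have h4' : u + v * -(β - 1) < β + 1 := by nlinarith
  have hlo : (1.6 : ℝ) < β := by nlinarith
  have hhi : β < 1.7 := by nlinarith
  have hv1 : v < 2 := by
    apply Int.lt_of_cast_mul_lt (P := 2 * β - 1) (by linarith)
    push_cast
    nlinarith
  have hv2 : -2 < v := by
    apply Int.lt_of_cast_mul_lt (P := 2 * β - 1) (by linarith)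
    push_cast
    nlinarith
  have hv : v = -1 ∨ v = 0 ∨ v = 1 := by omega
  have hu : -2 < u ∧ u < 2 := by
    rcases hv with rfl | rfl | rfl <;> push_cast at * <;>
    exact ⟨by exact_mod_cast (by linarith : (-2 : ℝ) < u),
      by exact_mod_cast (by linarith : (u : ℝ) < 2)⟩
  simp only [Finset.mem_Icc]
  omega

/-- A negative base allows digits of one sign only, and then two nonzero candidates remain. They are
harmless: in each, `u` and `v` are themselves digits, as `1 ≤ m = b - a`. -/
theorem bounds_neg_pos (hβ : 1 < β) (hβδ : β * δ = 1)
    (hm : β - δ = m) (ha : a ≤ 0) (hb : 0 ≤ b) (hab : b - a = m) {u v : ℤ}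
    (h1 : a * β - b ≤ (β ^ 2 - 1) * (u + v * -β)) (h2 : (β ^ 2 - 1) * (u + v * -β) ≤ b * β - a)
    (h3 : a < (1 - δ) * (u + v * δ)) (h4 : (1 - δ) * (u + v * δ) < b) :
    (u = 0 ∧ v = 0) ∨ (b = 0 ∧ ((u = -1 ∧ v = 0) ∨ (u = a ∧ v = -1))) ∨
      (a = 0 ∧ ((u = 1 ∧ v = 0) ∨ (u = b ∧ v = 1))) := by
  have ha' : (a : ℝ) ≤ 0 := by exact_mod_cast ha
  have hb' : (0 : ℝ) ≤ b := by exact_mod_cast hb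
  have hab' : (b : ℝ) - a = β - δ := by rw [hm]; exact_mod_cast hab
  have hδ : 0 < δ := by
    by_contra! hle
    nlinarith
  have hδ1 : δ < 1 := by nlinarith
  have hm1 : 1 ≤ m := by
    have : (0 : ℝ) < m := by rw [← hm]; linarith
    exact_mod_cast this
  have hP : 0 < (β + δ) * (β ^ 2 - 1) := mul_pos (by linarith) (by nlinarith)
  have hPm : (β + δ) * (β ^ 2 - 1) = (β - δ) * (β ^ 2 + 1) := by
    linear_combination (2 * β) * hβδ
  have hβ2 : 0 < β * (β + 1) := by positivity
  have h3' : a * (β * (β + 1)) < (β ^ 2 - 1) * (u + v * δ) := by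
    have := mul_lt_mul_of_pos_right h3 hβ2
    linear_combination this - (u + v * δ) * (β + 1) * hβδ
  have h4' : (β ^ 2 - 1) * (u + v * δ) < b * (β * (β + 1)) := by
    have := mul_lt_mul_of_pos_right h4 hβ2
    linear_combination this + (u + v * δ) * (β + 1) * hβδ
  have e : (b - a) * β = β ^ 2 - 1 := by rw [hab']; linear_combination -hβδ
  have e1 : -v * ((β + δ) * (β ^ 2 - 1)) < (b - a) * β - a * (1 + β ^ 2) := by
    linear_combination h2 + h3'
  have e2 : v * ((β + δ) * (β ^ 2 - 1)) < (b - a) * β + b * (1 + β ^ 2) := by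
    linear_combination h1 + h4'
  have hv1 : b ≤ m - 1 → v < 1 := by
    intro hbm
    have hbm' : (b : ℝ) ≤ β - δ - 1 := by rw [hm]; exact_mod_cast hbm
    apply Int.lt_of_cast_mul_lt hP
    have q : b * (1 + β ^ 2) ≤ (β - δ - 1) * (1 + β ^ 2) :=
      mul_le_mul_of_nonneg_right hbm' (by positivity)
    push_cast
    linarith
  have hv2 : -a ≤ m - 1 → -v < 1 := by
    intro ham
    have ham' : -(a : ℝ) ≤ β - δ - 1 := by rw [hm]; exact_mod_cast ham
    apply Int.lt_of_cast_mul_lt hP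
    have q : -a * (1 + β ^ 2) ≤ (β - δ - 1) * (1 + β ^ 2) :=
      mul_le_mul_of_nonneg_right ham' (by positivity)
    push_cast
    linarith
  have hββ : 0 < β ^ 2 - 1 := by nlinarith
  have hδm : β < m + 1 := by linarith
  have em : (m : ℝ) * β = β ^ 2 - 1 := by rw [← hm]; linear_combination -hβδ
  have hmR : (0 : ℝ) < m := by exact_mod_cast hm1
  have em1 : (m : ℝ) < β ^ 2 - 1 := by rw [← em]; exact lt_mul_of_one_lt_right hmR hβ
  have em2 : (m : ℝ) * β < m * (β ^ 2 + 1) := mul_lt_mul_of_pos_left (by linarith) hmR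
  by_cases hbm : b ≤ m - 1
  · have hbm' : (b : ℝ) ≤ β - δ - 1 := by rw [hm]; exact_mod_cast hbm
    by_cases ham : -a ≤ m - 1
    · left
      have ham' : -(a : ℝ) ≤ β - δ - 1 := by rw [hm]; exact_mod_cast ham
      obtain rfl : v = 0 := by have := hv1 hbm; have := hv2 ham; omega
      have q1 : b * (β - 1) ≤ (β - δ - 1) * (β - 1) :=
        mul_le_mul_of_nonneg_right hbm' (by linarith)
      have q2 : -a * (β - 1) ≤ (β - δ - 1) * (β - 1) :=
        mul_le_mul_of_nonneg_right ham' (by linarith)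
      simp only [Int.cast_zero, zero_mul, add_zero] at h1 h2
      have hu1 : u < 1 := by
        apply Int.lt_of_cast_mul_lt hββ
        push_cast
        linarith
      have hu2 : -u < 1 := by
        apply Int.lt_of_cast_mul_lt hββ
        push_cast
        linarith
      exact ⟨by omega, rfl⟩
    · have hv1' := hv1 hbm
      obtain rfl : b = 0 := by omega
      obtain rfl : a = -m := by omega
      push_cast at h1 h2 h3 e1
      have hv3 : -v < 2 := by
        apply Int.lt_of_cast_mul_lt hP
        push_cast
        rw [hPm, hm] at e1 ⊢
        linarith
      have hv : v = 0 ∨ v = -1 := by omega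
      rcases hv with rfl | rfl
      · simp only [Int.cast_zero, zero_mul, add_zero] at h1 h2
        have hu1 : u < 1 := by
          apply Int.lt_of_cast_mul_lt hββ
          push_cast
          linarith
        have hu2 : -u < 2 := by
          apply Int.lt_of_cast_mul_lt hββ
          push_cast
          linarith
        omega
      · push_cast at h1 h2 h3
        have k1 : (u : ℝ) + β ≤ δ := by
          refine le_of_mul_le_mul_left (a := β ^ 2 - 1) ?_ hββ
          have : (β ^ 2 - 1) * δ = m := by rw [← hm]; linear_combination β * hβδ
          linarith
        have k2 : (-1 : ℝ) ≤ u + β := by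
          refine le_of_mul_le_mul_left (a := β ^ 2 - 1) ?_ hββ
          linarith
        have hu1 : u ≤ -m := by
          have : (u : ℝ) ≤ -m := by linarith
          exact_mod_cast this
        have hu2 : -m - 2 < u := by
          have : -(m : ℝ) - 2 < u := by linarith
          exact_mod_cast this
        have hu3 : u ≠ -m - 1 := by
          rintro rfl
          push_cast at h3
          rw [← hm] at h3
          linarith
        omega
  · have hv2' := hv2 (by omega)
    obtain rfl : a = 0 := by omega
    obtain rfl : b = m := by omega
    push_cast at h1 h2 h4 e2
    have hv3 : v < 2 := by
      apply Int.lt_of_cast_mul_lt hP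
      push_cast
      rw [hPm, hm] at e2 ⊢
      linarith
    have hv : v = 0 ∨ v = 1 := by omega
    rcases hv with rfl | rfl
    · simp only [Int.cast_zero, zero_mul, add_zero] at h1 h2
      have hu1 : -u < 1 := by
        apply Int.lt_of_cast_mul_lt hββ
        push_cast
        linarith
      have hu2 : u < 2 := by
        apply Int.lt_of_cast_mul_lt hββ
        push_cast
        linarith
      omega
    · push_cast at h1 h2 h4
      have k1 : -δ ≤ (u : ℝ) - β := by
        refine le_of_mul_le_mul_left (a := β ^ 2 - 1) ?_ hββ
        have : (β ^ 2 - 1) * δ = b := by rw [← hm]; linear_combination β * hβδ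
        linarith
      have k2 : (u : ℝ) - β ≤ 1 := by
        refine le_of_mul_le_mul_left (a := β ^ 2 - 1) ?_ hββ
        linarith
      have hu1 : b ≤ u := by
        have : (b : ℝ) ≤ u := by linarith
        exact_mod_cast this
      have hu2 : u < b + 2 := by
        have : (u : ℝ) < b + 2 := by linarith
        exact_mod_cast this
      have hu3 : u ≠ b + 1 := by
        rintro rfl
        push_cast at h4
        rw [← hm] at h4
        linarith
      omega

theorem eq_zero_of_bounds_neg_neg (hβ : 1 < β) (hβδ : β * δ = 1)
    (hm : β + δ = m) (ha : a ≤ 0) (hb : 0 ≤ b) (hab : b - a = m - 1) {u v : ℤ}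
    (h1 : a * β - b ≤ (β ^ 2 - 1) * (u + v * -β)) (h2 : (β ^ 2 - 1) * (u + v * -β) ≤ b * β - a)
    (h3 : a - b * δ < (1 - δ ^ 2) * (u + v * -δ))
    (h4 : (1 - δ ^ 2) * (u + v * -δ) < b - a * δ) : u = 0 ∧ v = 0 := by
  have ha' : (a : ℝ) ≤ 0 := by exact_mod_cast ha
  have hb' : (0 : ℝ) ≤ b := by exact_mod_cast hb
  have hab' : (b : ℝ) - a = β + δ - 1 := by rw [hm]; exact_mod_cast hab
  have hδ : 0 < δ := by
    by_contra! hle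
    nlinarith
  have hδ1 : δ < 1 := by nlinarith
  have hm3 : 3 ≤ m := by
    have : (2 : ℝ) < m := by rw [← hm]; nlinarith [sq_nonneg (β - 1)]
    have : 2 < m := by exact_mod_cast this
    omega
  have hm3' : (3 : ℝ) ≤ m := by exact_mod_cast hm3
  have hβ0 : 0 < β := by linarith
  have hβ2 : 0 < β ^ 2 := by positivity
  have hββ : 0 < β ^ 2 - 1 := by nlinarith
  have em : (m : ℝ) * β = β ^ 2 + 1 := by rw [← hm]; linear_combination hβδ
  have h3' : a * β ^ 2 - b * β < (β ^ 2 - 1) * (u + v * -δ) := by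
    have := mul_lt_mul_of_pos_right h3 hβ2
    linear_combination this - ((u + v * -δ) * (β * δ + 1) - b * β) * hβδ
  have h4' : (β ^ 2 - 1) * (u + v * -δ) < b * β ^ 2 - a * β := by
    have := mul_lt_mul_of_pos_right h4 hβ2
    linear_combination this + ((u + v * -δ) * (β * δ + 1) - a * β) * hβδ
  -- Here `β² - 1 = β (β - δ)` and `(β - δ)² = m² - 4`. After cancelling `β`, the bounds on `v` are
  -- inequalities between integers.
  have eP : (β ^ 2 - 1) * (β - δ) = β * (m ^ 2 - 4) := by
    rw [← hm]
    linear_combination -(3 * β + δ) * hβδ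
  have e1 : -v * (m ^ 2 - 4) < 2 * b - a * m := by
    have : (-v * (m ^ 2 - 4) : ℝ) < 2 * b - a * m := by
      refine lt_of_mul_lt_mul_left (a := β) ?_ hβ0.le
      linear_combination h2 + h3' + v * eP + a * em
    exact_mod_cast this
  have e2 : v * (m ^ 2 - 4) < b * m - 2 * a := by
    have : (v * (m ^ 2 - 4) : ℝ) < b * m - 2 * a := by
      refine lt_of_mul_lt_mul_left (a := β) ?_ hβ0.le
      linear_combination h1 + h4' - v * eP - b * em
    exact_mod_cast this
  obtain rfl : b = a + m - 1 := by omega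
  push_cast at h1 h2 h3' h4'
  have hq : 0 ≤ m ^ 2 - 4 := by nlinarith
  -- The integer inequality leaves only `m = 3`, `v = -1` and the digits `-2, -1, 0`; there the
  -- bounds on `u` contain no integer. The other sign is symmetric.
  have hv1 : -v < 1 := by
    by_contra! hle
    have q1 : m ^ 2 - 4 < 2 * (a + m - 1) - a * m := by
      linarith [mul_le_mul_of_nonneg_right hle hq]
    obtain rfl : a = 1 - m := by
      by_contra hne
      have : 2 - m ≤ a := by omega
      nlinarith
    have q3 : m = 3 := by
      have : m < 4 := by linarith
      omega
    subst q3
    obtain rfl : v = -1 := by omega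
    push_cast at h1 h2 h3' h4' em
    have : u < -2 := by
      by_contra! hu
      have hu' : (-2 : ℝ) ≤ u := by exact_mod_cast hu
      nlinarith
    have hu' : (u : ℝ) ≤ -3 := by exact_mod_cast (by omega : u ≤ -3)
    nlinarith
  have hv2 : v < 1 := by
    by_contra! hle
    have q1 : m ^ 2 - 4 < (a + m - 1) * m - 2 * a := by
      linarith [mul_le_mul_of_nonneg_right hle hq]
    obtain rfl : a = 0 := by
      by_contra hne
      have : a ≤ -1 := by omega
      nlinarith
    have q3 : m = 3 := by
      have : m < 4 := by linarith
      omega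
    subst q3
    obtain rfl : v = 1 := by omega
    push_cast at h1 h2 h3' h4' em
    have : 2 < u := by
      by_contra! hu
      have hu' : (u : ℝ) ≤ 2 := by exact_mod_cast hu
      nlinarith
    have hu' : (3 : ℝ) ≤ u := by exact_mod_cast (by omega : 3 ≤ u)
    nlinarith
  obtain rfl : v = 0 := by omega
  simp only [Int.cast_zero, zero_mul, add_zero] at h1 h2
  have hβ3 : 2 < β := by linarith
  have q1 : 0 ≤ -(a : ℝ) * (β - 1) := mul_nonneg (by linarith) (by linarith)
  have q2 : 0 ≤ (a + m - 1 : ℝ) * (β - 1) := mul_nonneg (by push_cast at hb'; linarith) (by linarith)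
  have hu1 : u < 1 := by
    apply Int.lt_of_cast_mul_lt hββ
    push_cast
    linarith
  have hu2 : -u < 1 := by
    apply Int.lt_of_cast_mul_lt hββ
    push_cast
    linarith
  exact ⟨by omega, rfl⟩

end Attractor

/-! ### The window is filled, in all four sign cases. -/

theorem add_mul_mem_digitSpectrum {A : Finset ℤ} {α : ℝ} {u v : ℤ} (hu : u ∈ A) (hv : v ∈ A) :
    (u + v * α : ℝ) ∈ digitSpectrum A α := by
  rw [mul_comm]
  exact digit_add_mul_mem_digitSpectrum hu (intCast_mem_digitSpectrum hv)

namespace IsConjugateUnitPair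

variable {β δ : ℝ} {a b m M ε : ℤ}

theorem fillsWindow_pos_pos (h : IsConjugateUnitPair β δ m 1) (hβ : 1 < β) (ha : a ≤ -1)
    (hb : 1 ≤ b) (hab : β < b - a + 1) : FillsWindow β δ a b := by
  have hβδ : β * δ = 1 := by simpa using h.mul_eq
  have hδ : 0 < δ := by
    by_contra! hle
    nlinarith
  have hδ1 : δ < 1 := by nlinarith
  have hm := h.add_eq
  have hm3 : 3 ≤ m := by
    have : (2 : ℝ) < m := by rw [← hm]; nlinarith [mul_pos (sub_pos.2 hβ) (sub_pos.2 hβ)]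
    have : 2 < m := by exact_mod_cast this
    omega
  have hlen : m ≤ b - a + 1 := by
    have : (m : ℝ) - 1 < b - a + 1 := by linarith
    have : m - 1 < b - a + 1 := by exact_mod_cast this
    omega
  obtain ⟨a₀, b₀, h1, h2, h3, h4, h5⟩ : ∃ a₀ b₀ : ℤ, a ≤ a₀ ∧ b₀ ≤ b ∧ a₀ ≤ -1 ∧ 1 ≤ b₀ ∧
      b₀ - a₀ = m - 1 :=
    -- A run of `m` digits inside `[a, b]` that still contains `-1` and `1`. It is long enough as `m
    -- = β + δ > β`.
    ⟨max a (2 - m), max a (2 - m) + m - 1, by omega, by omega, by omega, by omega, by omega⟩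
  have h5' : (b₀ : ℝ) - a₀ = m - 1 := by exact_mod_cast h5
  have hcard : |β| < b₀ - a₀ + 1 := by rw [abs_of_pos (by linarith)]; linarith
  refine h.fillsWindow_of_le h1 h2 (by omega) hcard
    (h.fillsWindow_of_attractor (by omega) hcard ?_)
  intro s r c hs hr hc u v hz hz'
  have hz := attractor_pos hβ hc hz
  have hz' := window_pos hδ hδ1 hs hr hz'
  obtain ⟨rfl, rfl⟩ := eq_zero_of_bounds_pos_pos hβ hδ hβδ hm h3 h4 h5 hz.1 hz.2 hz'.1 hz'.2
  exact add_mul_mem_digitSpectrum (by simp; omega) (by simp; omega)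

theorem fillsWindow_pos_neg (h : IsConjugateUnitPair β (-δ) m (-1)) (hβ : 1 < β) (ha : a ≤ -1)
    (hb : 1 ≤ b) (hab : β < b - a + 1) : FillsWindow β (-δ) a b := by
  have hβδ : β * δ = 1 := by simpa using h.mul_eq
  have hδ : 0 < δ := by
    by_contra! hle
    nlinarith
  have hδ1 : δ < 1 := by nlinarith
  have hm : β - δ = m := by rw [sub_eq_add_neg]; exact h.add_eq
  have hm1 : 1 ≤ m := by
    have : (0 : ℝ) < m := by rw [← hm]; linarith
    exact_mod_cast this
  have hlen : m + 1 ≤ b - a + 1 := by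
    have : (m : ℝ) < b - a + 1 := by linarith
    exact_mod_cast this
  rcases hm1.eq_or_lt with rfl | hm2
  · have hcard : |β| < ((1 : ℤ) : ℝ) - ((-1 : ℤ) : ℝ) + 1 := by
      rw [abs_of_pos (by linarith)]
      push_cast at hm ⊢
      linarith
    refine h.fillsWindow_of_le ha hb (by omega) hcard
      (h.fillsWindow_of_attractor (by omega) hcard ?_)
    intro s r c hs hr hc u v hz hz'
    have hz := attractor_pos hβ hc hz
    have hz' := window_neg hδ hδ1 hs hr hz'
    push_cast at hz hz' hm
    have huv := cases_of_bounds_golden hβ hδ hβδ hm hz.1 (by linarith [hz.2])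
      (by linarith [hz'.1]) (by linarith [hz'.2])
    exact add_mul_mem_digitSpectrum huv.1 huv.2
  · obtain ⟨a₀, b₀, h1, h2, h3, h4, h5⟩ : ∃ a₀ b₀ : ℤ, a ≤ a₀ ∧ b₀ ≤ b ∧ a₀ ≤ -1 ∧ 1 ≤ b₀ ∧
        b₀ - a₀ = m :=
      ⟨max a (1 - m), max a (1 - m) + m, by omega, by omega, by omega, by omega, by omega⟩
    have h5' : (b₀ : ℝ) - a₀ = m := by exact_mod_cast h5
    have hcard : |β| < b₀ - a₀ + 1 := by rw [abs_of_pos (by linarith)]; linarith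
    refine h.fillsWindow_of_le h1 h2 (by omega) hcard
      (h.fillsWindow_of_attractor (by omega) hcard ?_)
    intro s r c hs hr hc u v hz hz'
    have hz := attractor_pos hβ hc hz
    have hz' := window_neg hδ hδ1 hs hr hz'
    obtain ⟨rfl, rfl⟩ := eq_zero_of_bounds_pos_neg hβ hδ hβδ hm h3 h4 h5 hz.1 hz.2 hz'.1 hz'.2
    exact add_mul_mem_digitSpectrum (by simp; omega) (by simp; omega)

theorem fillsWindow_neg_pos (h : IsConjugateUnitPair (-β) δ (-m) (-1)) (hβ : 1 < β) (ha : a ≤ 0)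
    (hb : 0 ≤ b) (hab : β < b - a + 1) : FillsWindow (-β) δ a b := by
  have hβδ : β * δ = 1 := by simpa using h.mul_eq
  have hδ : 0 < δ := by
    by_contra! hle
    nlinarith
  have hδ1 : δ < 1 := by nlinarith
  have hm : β - δ = m := by
    have := h.add_eq
    push_cast at this
    linarith
  have hm1 : 1 ≤ m := by
    have : (0 : ℝ) < m := by rw [← hm]; linarith
    exact_mod_cast this
  have hlen : m + 1 ≤ b - a + 1 := by
    have : (m : ℝ) < b - a + 1 := by linarith
    exact_mod_cast this
  obtain ⟨a₀, b₀, h1, h2, h3, h4, h5⟩ : ∃ a₀ b₀ : ℤ, a ≤ a₀ ∧ b₀ ≤ b ∧ a₀ ≤ 0 ∧ 0 ≤ b₀ ∧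
      b₀ - a₀ = m :=
    ⟨max a (-m), max a (-m) + m, by omega, by omega, by omega, by omega, by omega⟩
  have h5' : (b₀ : ℝ) - a₀ = m := by exact_mod_cast h5
  have hcard : |-β| < b₀ - a₀ + 1 := by rw [abs_neg, abs_of_pos (by linarith)]; linarith
  refine h.fillsWindow_of_le h1 h2 (by omega) hcard
    (h.fillsWindow_of_attractor (by omega) hcard ?_)
  intro s r c hs hr hc u v hz hz'
  have hz := attractor_neg hβ hc hz
  have hz' := window_pos hδ hδ1 hs hr hz'
  have huv := bounds_neg_pos hβ hβδ hm h3 h4 h5 hz.1 hz.2 hz'.1 hz'.2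
  exact add_mul_mem_digitSpectrum (by rw [Finset.mem_Icc]; omega) (by rw [Finset.mem_Icc]; omega)

theorem fillsWindow_neg_neg (h : IsConjugateUnitPair (-β) (-δ) (-m) 1) (hβ : 1 < β) (ha : a ≤ 0)
    (hb : 0 ≤ b) (hab : β < b - a + 1) : FillsWindow (-β) (-δ) a b := by
  have hβδ : β * δ = 1 := by simpa using h.mul_eq
  have hδ : 0 < δ := by
    by_contra! hle
    nlinarith
  have hδ1 : δ < 1 := by nlinarith
  have hm : β + δ = m := by
    have := h.add_eq
    push_cast at this
    linarith
  have hm1 : 1 ≤ m := by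
    have : (0 : ℝ) < m := by rw [← hm]; linarith
    exact_mod_cast this
  have hlen : m ≤ b - a + 1 := by
    have : (m : ℝ) - 1 < b - a + 1 := by linarith
    have : m - 1 < b - a + 1 := by exact_mod_cast this
    omega
  obtain ⟨a₀, b₀, h1, h2, h3, h4, h5⟩ : ∃ a₀ b₀ : ℤ, a ≤ a₀ ∧ b₀ ≤ b ∧ a₀ ≤ 0 ∧ 0 ≤ b₀ ∧
      b₀ - a₀ = m - 1 :=
    ⟨max a (1 - m), max a (1 - m) + m - 1, by omega, by omega, by omega, by omega, by omega⟩
  have h5' : (b₀ : ℝ) - a₀ = m - 1 := by exact_mod_cast h5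
  have hcard : |-β| < b₀ - a₀ + 1 := by rw [abs_neg, abs_of_pos (by linarith)]; linarith
  refine h.fillsWindow_of_le h1 h2 (by omega) hcard
    (h.fillsWindow_of_attractor (by omega) hcard ?_)
  intro s r c hs hr hc u v hz hz'
  have hz := attractor_neg hβ hc hz
  have hz' := window_neg hδ hδ1 hs hr hz'
  obtain ⟨rfl, rfl⟩ := eq_zero_of_bounds_neg_neg hβ hβδ hm h3 h4 h5 hz.1 hz.2 hz'.1 hz'.2
  exact add_mul_mem_digitSpectrum (by simp; omega) (by simp; omega)

theorem fillsWindow {α α' : ℝ} (h : IsConjugateUnitPair α α' M ε) (hβ : 1 < β) (ha : a ≤ 0)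
    (hb : 0 ≤ b) (hab : β < b - a + 1) (hα : α = -β ∨ (α = β ∧ a ≤ -1 ∧ 1 ≤ b)) :
    FillsWindow α α' a b := by
  -- Conjugate and trace are written as negatives to match the form of the lemmas for a negative
  -- base.
  obtain ⟨δ, rfl⟩ : ∃ δ, α' = -δ := ⟨-α', (neg_neg _).symm⟩
  obtain ⟨m, rfl⟩ : ∃ m, M = -m := ⟨-M, (neg_neg _).symm⟩
  rcases hα with rfl | ⟨rfl, ha', hb'⟩ <;> rcases h.norm_eq with rfl | rfl
  · exact h.fillsWindow_neg_neg hβ ha hb hab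
  · exact h.fillsWindow_neg_pos hβ ha hb hab
  · exact h.fillsWindow_pos_pos hβ ha' hb' hab
  · exact h.fillsWindow_pos_neg hβ ha' hb' hab

end IsConjugateUnitPair

/-! ### The shape of the window and the coding of the gaps. -/

namespace IsConjugateUnitPair

variable {α α' : ℝ} {M ε a b : ℤ} {s r : ℝ}

theorem exists_linEval_pow_mul (h : IsConjugateUnitPair α α' M ε) (k : ℕ) (z : ℤ × ℤ) :
    ∃ w, linEval α w = α ^ k * linEval α z ∧ linEval α' w = α' ^ k * linEval α' z := by
  induction k with
  | zero => exact ⟨z, by simp, by simp⟩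
  | succ k ih =>
    obtain ⟨w, hw, hw'⟩ := ih
    obtain ⟨y, hy, hy'⟩ := h.exists_linEval_mul w
    exact ⟨y, by rw [hy, hw]; ring, by rw [hy', hw']; ring⟩

/-- Multiplication by an even power of `α` keeps the signs of both embeddings and shrinks the
conjugate. -/
theorem exists_pos_scaled (h : IsConjugateUnitPair α α' M ε) {z : ℤ × ℤ} (hz : 0 < linEval α z)
    {η : ℝ} (hη : 0 < η) :
    ∃ w c, 0 < c ∧ 0 < linEval α w ∧ linEval α' w = c * linEval α' z ∧ |linEval α' w| < η := by
  have h2 : |α' ^ 2| < 1 := by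
    rw [abs_pow]
    exact pow_lt_one₀ (abs_nonneg _) h.abs_lt_one two_ne_zero
  have hlim := ((tendsto_pow_atTop_nhds_zero_of_abs_lt_one h2).mul_const (linEval α' z)).abs
  rw [zero_mul, abs_zero] at hlim
  obtain ⟨k, hk⟩ := (hlim.eventually_lt_const hη).exists
  obtain ⟨w, hw, hw'⟩ := h.exists_linEval_pow_mul (2 * k) z
  rw [pow_mul] at hw hw'
  have := sq_pos_of_ne_zero h.ne_zero
  have := sq_pos_of_ne_zero h.ne_zero'
  refine ⟨w, (α' ^ 2) ^ k, by positivity, ?_, hw', by rwa [hw']⟩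
  rw [hw]
  positivity

theorem exists_pos_small_pos (h : IsConjugateUnitPair α α' M ε) {η : ℝ} (hη : 0 < η) :
    ∃ z, 0 < linEval α z ∧ 0 < linEval α' z ∧ linEval α' z < η := by
  obtain ⟨w, c, hc, hw, hw', hlt⟩ := h.exists_pos_scaled (z := (1, 0)) (by simp [linEval_apply]) hη
  refine ⟨w, hw, ?_, (abs_lt.1 hlt).2⟩
  rw [hw', linEval_apply]
  simpa using hc

theorem exists_pos_small_neg (h : IsConjugateUnitPair α α' M ε) {η : ℝ} (hη : 0 < η) :
    ∃ z, 0 < linEval α z ∧ -η < linEval α' z ∧ linEval α' z < 0 := by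
  have h1 := abs_lt.1 h.abs_lt_one
  obtain ⟨z, hz, hz'⟩ : ∃ z, 0 < linEval α z ∧ linEval α' z < 0 := by
    rcases lt_abs.1 h.one_lt_abs with h2 | h2
    · exact ⟨(-1, 1), by simp only [linEval_apply]; push_cast; linarith,
        by simp only [linEval_apply]; push_cast; linarith⟩
    · exact ⟨(-1, -1), by simp only [linEval_apply]; push_cast; linarith,
        by simp only [linEval_apply]; push_cast; linarith⟩
  obtain ⟨w, c, hc, hw, hw', hlt⟩ := h.exists_pos_scaled hz hη
  refine ⟨w, hw, (abs_lt.1 hlt).1, ?_⟩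
  rw [hw']
  exact mul_neg_of_pos_of_neg hc hz'

theorem exists_linEval_mem_Ioo (h : IsConjugateUnitPair α α' M ε) {c d : ℝ} (hcd : c < d) :
    ∃ z, linEval α' z ∈ Set.Ioo c d := by
  obtain ⟨z, -, hz, hz'⟩ := h.exists_pos_small_pos (sub_pos.2 hcd)
  refine ⟨(⌊c / linEval α' z⌋ + 1) • z, ?_⟩
  rw [map_zsmul, zsmul_eq_mul]
  push_cast
  have h1 := Int.floor_le (c / linEval α' z)
  have h2 := Int.lt_floor_add_one (c / linEval α' z)
  rw [le_div_iff₀ hz] at h1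
  rw [div_lt_iff₀ hz] at h2
  exact ⟨h2, by linarith⟩

/-- The interval contains `0` and is mapped into itself by every `x ↦ d + α' x`. -/
theorem abs_sub_le_of_mem (h : IsConjugateUnitPair α α' M ε) (ha : a ≤ 0) (hb : 0 ≤ b)
    (hs : s = (a + b) / 2 + α' * s) (hr : r = (b - a) / 2 + |α'| * r) :
    ∀ x ∈ digitSpectrum (Finset.Icc a b) α', |x - s| ≤ r := by
  have hstep : ∀ d ∈ Finset.Icc a b, |(d : ℝ) - (a + b) / 2| ≤ (b - a) / 2 := by
    intro d hd
    rw [Finset.mem_Icc] at hd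
    have hd1 : (a : ℝ) ≤ d := by exact_mod_cast hd.1
    have hd2 : (d : ℝ) ≤ b := by exact_mod_cast hd.2
    rw [abs_le]; constructor <;> linarith
  apply digitSpectrum_induction
  · have h0 := hstep 0 (Finset.mem_Icc.2 ⟨ha, hb⟩)
    have h1 := h.abs_lt_one
    have h2 : (0 - s) = (((0 : ℤ) : ℝ) - (a + b) / 2) + α' * (0 - s) := by
      push_cast
      linear_combination -hs
    have h3 : |0 - s| ≤ (b - a) / 2 + |α'| * |0 - s| := by
      nth_rw 1 [h2]
      rw [← abs_mul]
      exact (abs_add_le _ _).trans (add_le_add_left h0 _)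
    nlinarith
  · intro d hd x hx
    rw [show d + α' * x - s = (d - (a + b) / 2) + α' * (x - s) by linear_combination -hs]
    refine (abs_add_le _ _).trans ?_
    rw [abs_mul]
    exact (add_le_add (hstep d hd) (mul_le_mul_of_nonneg_left hx (abs_nonneg _))).trans hr.ge

/-- The window of the spectrum contains at most one of its end-points. -/
theorem not_both_endpoints_mem (h : IsConjugateUnitPair α α' M ε) (ha : a ≤ 0) (hb : 0 ≤ b)
    (hab : a < b) (hs : s = (a + b) / 2 + α' * s) (hr : r = (b - a) / 2 + |α'| * r)
    (hl : s - r ∈ digitSpectrum (Finset.Icc a b) α')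
    (hu : s + r ∈ digitSpectrum (Finset.Icc a b) α') : False := by
  have hle := h.abs_sub_le_of_mem ha hb hs hr
  have hab' : (a : ℝ) < b := by exact_mod_cast hab
  have ha' : (a : ℝ) ≤ 0 := by exact_mod_cast ha
  have hb' : (0 : ℝ) ≤ b := by exact_mod_cast hb
  have h1 := h.abs_lt_one
  have hr0 : 0 < r := by
    by_contra! hr0
    nlinarith
  have hbd : ∀ d ∈ Finset.Icc a b, (a : ℝ) ≤ d ∧ (d : ℝ) ≤ b := by
    intro d hd
    rw [Finset.mem_Icc] at hd
    exact ⟨by exact_mod_cast hd.1, by exact_mod_cast hd.2⟩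
  rcases lt_or_gt_of_ne h.ne_zero' with hneg | hpos
  · rw [abs_of_neg hneg] at hr h1
    -- For `α' < 0` one has `s - r = a + α' (s + r)` and `s + r = b + α' (s - r)`: reaching an
    -- end-point requires having reached the other one before, and `0` is interior.
    have key : ∀ x ∈ digitSpectrum (Finset.Icc a b) α', s - r < x ∧ x < s + r := by
      apply digitSpectrum_induction
      · constructor
        · by_contra! hge
          nlinarith
        · by_contra! hge
          nlinarith
      · rintro d hd x ⟨hx1, hx2⟩
        obtain ⟨hd1, hd2⟩ := hbd d hd
        constructor <;> nlinarith
    exact lt_irrefl _ (key _ hl).1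
  · rw [abs_of_pos hpos] at hr h1
    -- For `α' > 0` each end-point is reached only from itself, so a finite expansion attains it
    -- only if it is `0`; both cannot be `0`.
    have key : ∀ x ∈ digitSpectrum (Finset.Icc a b) α', (s - r ≤ x ∧ x ≤ s + r) ∧
        (x = s - r → s - r = 0) ∧ (x = s + r → s + r = 0) := by
      apply digitSpectrum_induction
      · have h0 := abs_le.1 (hle 0 (zero_mem_digitSpectrum (Finset.mem_Icc.2 ⟨ha, hb⟩)))
        exact ⟨⟨by linarith, by linarith⟩, fun h => h.symm, fun h => h.symm⟩
      · rintro d hd x ⟨⟨hx1, hx2⟩, hx3, hx4⟩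
        obtain ⟨hd1, hd2⟩ := hbd d hd
        have e1 : s - r = a + α' * (s - r) := by linear_combination hs - hr
        have e2 : s + r = b + α' * (s + r) := by linear_combination hs + hr
        have f1 := mul_le_mul_of_nonneg_left hx1 hpos.le
        have f2 := mul_le_mul_of_nonneg_left hx2 hpos.le
        refine ⟨⟨by linarith, by linarith⟩, fun hx => hx3 ?_, fun hx => hx4 ?_⟩
        · exact mul_left_cancel₀ hpos.ne' (by linarith)
        · exact mul_left_cancel₀ hpos.ne' (by linarith)
    linarith [(key _ hl).2.1 rfl, (key _ hu).2.2 rfl]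

theorem mem_of_conj_mem_Ioo (h : IsConjugateUnitPair α α' M ε) (hfill : FillsWindow α α' a b)
    (ha : a ≤ 0) (hb : 0 ≤ b) (hs : s = (a + b) / 2 + α' * s) (hr : r = (b - a) / 2 + |α'| * r)
    {z : ℤ × ℤ} (hz : linEval α' z ∈ Set.Ioo (s - r) (s + r)) :
    linEval α' z ∈ digitSpectrum (Finset.Icc a b) α' := by
  rw [← h.linEval_mem_iff (Finset.mem_Icc.2 ⟨ha, hb⟩)]
  exact hfill s r hs hr z (abs_lt.2 ⟨by linarith [hz.1], by linarith [hz.2]⟩)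

theorem sInf_sSup_digitSpectrum (h : IsConjugateUnitPair α α' M ε)
    (hfill : FillsWindow α α' a b) (ha : a ≤ 0) (hb : 0 ≤ b) (hr0 : 0 < r)
    (hs : s = (a + b) / 2 + α' * s) (hr : r = (b - a) / 2 + |α'| * r) :
    sInf (digitSpectrum (Finset.Icc a b) α') = s - r ∧
      sSup (digitSpectrum (Finset.Icc a b) α') = s + r := by
  have hle := h.abs_sub_le_of_mem ha hb hs hr
  have hne : (digitSpectrum (Finset.Icc a b) α').Nonempty :=
    ⟨0, zero_mem_digitSpectrum (Finset.mem_Icc.2 ⟨ha, hb⟩)⟩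
  constructor
  · refine csInf_eq_of_forall_ge_of_forall_gt_exists_lt hne
      (fun x hx => by linarith [(abs_le.1 (hle x hx)).1]) fun w hw => ?_
    obtain ⟨z, hz1, hz2⟩ := h.exists_linEval_mem_Ioo (lt_min hw (by linarith : s - r < s + r))
    exact ⟨_, h.mem_of_conj_mem_Ioo hfill ha hb hs hr
      ⟨hz1, hz2.trans_le (min_le_right _ _)⟩, hz2.trans_le (min_le_left _ _)⟩
  · refine csSup_eq_of_forall_le_of_forall_lt_exists_gt hne
      (fun x hx => by linarith [(abs_le.1 (hle x hx)).2]) fun w hw => ?_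
    obtain ⟨z, hz1, hz2⟩ := h.exists_linEval_mem_Ioo (max_lt hw (by linarith : s - r < s + r))
    exact ⟨_, h.mem_of_conj_mem_Ioo hfill ha hb hs hr
      ⟨(le_max_right _ _).trans_lt hz1, hz2⟩, (le_max_left _ _).trans_lt hz1⟩

/-- The coding of the gaps, for the window `J + t` after scaling the conjugation by `κ`. -/
theorem exists_codesOrbit_of_window (h : IsConjugateUnitPair α α' M ε) {κ t : ℝ} (hκ : κ ≠ 0)
    {J : Set ℝ} (hJ : J = Set.Ico 0 1 ∨ J = Set.Ioo 0 1) (ha : a ≤ 0) (hb : 0 ≤ b)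
    (hX : ∀ z, linEval α' z ∈ digitSpectrum (Finset.Icc a b) α' ↔ κ * linEval α' z - t ∈ J)
    {Q : Prop} (hQ : Q → J = Set.Ico 0 1) :
    ∃ Δ₁ Δ₂ : ℝ, 0 < Δ₁ ∧ 0 < Δ₂ ∧ Δ₁ ≠ Δ₂ ∧
      (∀ x y : ℝ, AreConsecutive (digitSpectrum (Finset.Icc a b) α) x y →
        y - x ∈ ({Δ₁, Δ₂, Δ₁ + Δ₂} : Set ℝ)) ∧
      ∃ y : ℤ → ℝ, StrictMono y ∧ Set.range y = digitSpectrum (Finset.Icc a b) α ∧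
        ∃ (lam mu : ℝ) (J IA IB IC : Set ℝ) (T : Equiv.Perm J) (ρ : J),
          IsThreeIntervalExchange lam mu J IA IB IC T ∧
          CodesOrbit (fun n => y (n + 1) - y n) Δ₁ (Δ₁ + Δ₂) Δ₂ J IA IB IC T ρ ∧
          (Q → AreLeftClosedRightOpen lam mu J IA IB IC) := by
  have hκ' : 0 < |κ| := abs_pos.2 hκ
  set g : ℤ × ℤ →+ ℝ := (AddMonoidHom.mulLeft κ).comp (linEval α') with hg
  have hgz : ∀ z, g z = κ * linEval α' z := fun z => rfl
  have h0 : (0 : ℤ) ∈ Finset.Icc a b := Finset.mem_Icc.2 ⟨ha, hb⟩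
  have hginj : Function.Injective g := fun z w hzw =>
    linEval_injective_of_irrational h.irrational' (mul_left_cancel₀ hκ hzw)
  have hfin : ∀ C : ℝ, {z | |linEval α z| ≤ C ∧ |g z| ≤ C}.Finite := by
    intro C
    refine (h.finite_bounded (max C (C / |κ|))).subset ?_
    rintro z ⟨h1, h2⟩
    refine ⟨h1.trans (le_max_left _ _), le_trans ?_ (le_max_right _ _)⟩
    rw [le_div_iff₀' hκ', ← abs_mul]
    exact h2
  obtain ⟨p, hp, hp1, hp2⟩ := h.exists_pos_small_pos (one_div_pos.2 hκ')
  obtain ⟨q, hq, hq1, hq2⟩ := h.exists_pos_small_neg (one_div_pos.2 hκ')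
  rw [lt_div_iff₀ hκ'] at hp2
  rw [neg_lt, lt_div_iff₀ hκ'] at hq1
  have hpos : ∃ z, 0 < linEval α z ∧ g z ∈ Set.Ioo 0 1 := by
    -- A negative `κ` reverses the window, so the two small conjugates exchange roles.
    rcases lt_or_gt_of_ne hκ with hk | hk
    · rw [abs_of_neg hk] at hq1
      exact ⟨q, hq, by rw [hgz]; exact mul_pos_of_neg_of_neg hk hq2, by rw [hgz]; linarith⟩
    · rw [abs_of_pos hk] at hp2
      exact ⟨p, hp, by rw [hgz]; exact mul_pos hk hp1, by rw [hgz]; linarith⟩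
  have hneg : ∃ z, 0 < linEval α z ∧ g z ∈ Set.Ioo (-1) 0 := by
    rcases lt_or_gt_of_ne hκ with hk | hk
    · rw [abs_of_neg hk] at hp2
      exact ⟨p, hp, by rw [hgz]; linarith, by rw [hgz]; exact mul_neg_of_neg_of_pos hk hp1⟩
    · rw [abs_of_pos hk] at hq1
      exact ⟨q, hq, by rw [hgz]; linarith, by rw [hgz]; exact mul_neg_of_pos_of_neg hk hq2⟩
  have hXeq : digitSpectrum (Finset.Icc a b) α = {x | ∃ z, linEval α z = x ∧ g z - t ∈ J} := by
    ext x
    constructor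
    · intro hx
      obtain ⟨z, hz, hz'⟩ := h.exists_linEval_eq_of_mem hx h0
      exact ⟨z, hz, (hX z).1 hz'⟩
    · rintro ⟨z, rfl, hz⟩
      exact (h.linEval_mem_iff h0 z).2 ((hX z).2 hz)
  obtain ⟨Δ₁, Δ₂, h1, h2, h3, h4, y, hy, hyX, lam, mu, IA, IB, IC, T, ρ, h5, h6, h7⟩ :=
    exists_codesOrbit_of_cutAndProject (linEval_injective_of_irrational h.irrational) hginj hfin
      hpos hneg hJ hXeq ⟨0, zero_mem_digitSpectrum h0⟩
  exact ⟨Δ₁, Δ₂, h1, h2, h3, h4, y, hy, hyX, lam, mu, J, IA, IB, IC, T, ρ, h5, h6,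
    fun hq => h7 (hQ hq)⟩

theorem exists_codesOrbit (h : IsConjugateUnitPair α α' M ε) (hfill : FillsWindow α α' a b)
    (ha : a ≤ 0) (hb : 0 ≤ b) (hab : a < b) {R : Set ℝ} (hR : ∀ z, linEval α' z ∈ R) :
    ∃ Δ₁ Δ₂ : ℝ, 0 < Δ₁ ∧ 0 < Δ₂ ∧ Δ₁ ≠ Δ₂ ∧
      (∀ x y : ℝ, AreConsecutive (digitSpectrum (Finset.Icc a b) α) x y →
        y - x ∈ ({Δ₁, Δ₂, Δ₁ + Δ₂} : Set ℝ)) ∧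
      ∃ y : ℤ → ℝ, StrictMono y ∧ Set.range y = digitSpectrum (Finset.Icc a b) α ∧
        ∃ (lam mu : ℝ) (J IA IB IC : Set ℝ) (T : Equiv.Perm J) (ρ : J),
          IsThreeIntervalExchange lam mu J IA IB IC T ∧
          CodesOrbit (fun n => y (n + 1) - y n) Δ₁ (Δ₁ + Δ₂) Δ₂ J IA IB IC T ρ ∧
          (¬ (sInf (digitSpectrum (Finset.Icc a b) α') ∈
                  R \ digitSpectrum (Finset.Icc a b) α' ∧
                sSup (digitSpectrum (Finset.Icc a b) α') ∈
                  R \ digitSpectrum (Finset.Icc a b) α') →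
            AreLeftClosedRightOpen lam mu J IA IB IC) := by
  have hα1 : 0 < 1 - |α'| := by linarith [h.abs_lt_one]
  have hα2 : 0 < 1 - α' := by linarith [le_abs_self α']
  have hab' : (a : ℝ) < b := by exact_mod_cast hab
  obtain ⟨s, hs⟩ : ∃ s : ℝ, s = (a + b) / 2 + α' * s :=
    ⟨(a + b) / 2 / (1 - α'), by field_simp; ring⟩
  obtain ⟨r, hr⟩ : ∃ r : ℝ, r = (b - a) / 2 + |α'| * r :=
    ⟨(b - a) / 2 / (1 - |α'|), by field_simp; ring⟩
  have hr0 : 0 < r := by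
    by_contra! hr0
    nlinarith
  obtain ⟨hinf, hsup⟩ := h.sInf_sSup_digitSpectrum hfill ha hb hr0 hs hr
  rw [hinf, hsup]
  have hle := h.abs_sub_le_of_mem ha hb hs hr
  have hin := fun z => h.mem_of_conj_mem_Ioo (z := z) hfill ha hb hs hr
  have hboth := h.not_both_endpoints_mem ha hb hab hs hr
  set X := digitSpectrum (Finset.Icc a b) α' with hX
  have hκ : (2 * r)⁻¹ ≠ 0 := by positivity
  have hpt : ∀ x, (2 * r)⁻¹ * x - (2 * r)⁻¹ * (s - r) = (x - (s - r)) / (2 * r) := fun x => by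
    rw [← mul_sub, inv_mul_eq_div]
  -- The second clause is vacuous if `s - r` is no conjugate, so `[s - r, s + r)` then serves as
  -- well. The next case is its mirror image, with `κ` negative. If both fail, neither end-point is
  -- in `X` and both are conjugates, which is the excluded situation.
  by_cases h1 : s + r ∉ X ∧ ∀ z, linEval α' z = s - r → s - r ∈ X
  · refine h.exists_codesOrbit_of_window (t := (2 * r)⁻¹ * (s - r)) hκ (Or.inl rfl) ha hb
      (fun z => ?_) fun _ => rfl
    rw [hpt, Set.mem_Ico, le_div_iff₀ (by linarith), div_lt_iff₀ (by linarith)]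
    constructor
    · intro hz
      have hz' := abs_le.1 (hle _ hz)
      have hne : linEval α' z ≠ s + r := fun he => h1.1 (he ▸ hz)
      have := lt_of_le_of_ne (by linarith [hz'.2] : linEval α' z ≤ s + r) hne
      constructor <;> linarith
    · rintro ⟨hz1, hz2⟩
      rcases eq_or_ne (linEval α' z) (s - r) with he | he
      · rw [he]; exact h1.2 z he
      · exact hin z ⟨lt_of_le_of_ne (by linarith) he.symm, by linarith⟩
  by_cases h2 : s - r ∉ X ∧ ∀ z, linEval α' z = s + r → s + r ∈ X
  · refine h.exists_codesOrbit_of_window (κ := -(2 * r)⁻¹) (t := -(2 * r)⁻¹ * (s + r))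
      (neg_ne_zero.2 hκ) (Or.inl rfl) ha hb (fun z => ?_) fun _ => rfl
    rw [← mul_sub, neg_mul, ← mul_neg, inv_mul_eq_div, Set.mem_Ico, le_div_iff₀ (by linarith),
      div_lt_iff₀ (by linarith)]
    constructor
    · intro hz
      have hz' := abs_le.1 (hle _ hz)
      have hne : linEval α' z ≠ s - r := fun he => h2.1 (he ▸ hz)
      have := lt_of_le_of_ne (by linarith [hz'.1] : s - r ≤ linEval α' z) hne.symm
      constructor <;> linarith
    · rintro ⟨hz1, hz2⟩
      rcases eq_or_ne (linEval α' z) (s + r) with he | he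
      · rw [he]; exact h2.2 z he
      · exact hin z ⟨by linarith, lt_of_le_of_ne (by linarith) he⟩
  have hl : s - r ∉ X := fun hl => h1 ⟨fun hu => hboth hl hu, fun _ _ => hl⟩
  have hu : s + r ∉ X := fun hu => h2 ⟨hl, fun _ _ => hu⟩
  refine h.exists_codesOrbit_of_window (t := (2 * r)⁻¹ * (s - r)) hκ (Or.inr rfl) ha hb
    (fun z => ?_) fun hQ => (hQ ⟨⟨?_, hl⟩, ?_, hu⟩).elim
  · rw [hpt, Set.mem_Ioo, lt_div_iff₀ (by linarith), div_lt_iff₀ (by linarith)]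
    constructor
    · intro hz
      have hz' := abs_le.1 (hle _ hz)
      have hne : linEval α' z ≠ s + r := fun he => hu (he ▸ hz)
      have hne' : linEval α' z ≠ s - r := fun he => hl (he ▸ hz)
      have := lt_of_le_of_ne (by linarith [hz'.2] : linEval α' z ≤ s + r) hne
      have := lt_of_le_of_ne (by linarith [hz'.1] : s - r ≤ linEval α' z) hne'.symm
      constructor <;> linarith
    · rintro ⟨hz1, hz2⟩
      exact hin z ⟨by linarith, by linarith⟩
  · by_contra hlR
    exact h1 ⟨hu, fun z hz => (hlR (hz ▸ hR z)).elim⟩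
  · by_contra huR
    exact h2 ⟨hl, fun z hz => (huR (hz ▸ hR z)).elim⟩

theorem eq_conj_of_aeval_minpoly (h : IsConjugateUnitPair α α' M ε) {x : ℝ}
    (hx : Polynomial.aeval x (minpoly ℚ α) = 0) (hne : x ≠ α) : x = α' := by
  let p : Polynomial ℚ := Polynomial.X ^ 2 - Polynomial.C (M : ℚ) * Polynomial.X +
    Polynomial.C (ε : ℚ)
  have hp : ∀ y : ℝ, Polynomial.aeval y p = y ^ 2 - M * y + ε := fun y => by simp [p]
  have hdvd : minpoly ℚ α ∣ p := by
    apply minpoly.dvd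
    rw [hp, ← h.add_eq, ← h.mul_eq]
    ring
  have h0 := Polynomial.aeval_eq_zero_of_dvd_aeval_eq_zero hdvd hx
  rw [hp, ← h.add_eq, ← h.mul_eq] at h0
  have h1 : (x - α) * (x - α') = 0 := by linear_combination h0
  rcases mul_eq_zero.1 h1 with h2 | h2
  · exact (hne (sub_eq_zero.1 h2)).elim
  · exact sub_eq_zero.1 h2

theorem neg (h : IsConjugateUnitPair α α' M ε) : IsConjugateUnitPair (-α) (-α') (-M) ε where
  irrational := h.irrational.neg
  add_eq := by push_cast; linear_combination -h.add_eq
  mul_eq := by rw [neg_mul_neg, h.mul_eq]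
  norm_eq := h.norm_eq
  one_lt_abs := by rw [abs_neg]; exact h.one_lt_abs

end IsConjugateUnitPair

/-! ### From Pisot units to conjugate pairs, and the theorem. -/

theorem irrational_of_natDegree_minpoly_eq_two {x : ℝ} (h : (minpoly ℚ x).natDegree = 2) :
    Irrational x := by
  rintro ⟨q, rfl⟩
  have := minpoly.eq_X_sub_C ℝ q
  rw [eq_ratCast] at this
  rw [this, Polynomial.natDegree_X_sub_C] at h
  omega

theorem exists_sq_eq_of_natDegree_minpoly_eq_two {x : ℝ} (hx : IsIntegral ℤ x)
    (h : (minpoly ℚ x).natDegree = 2) : ∃ p q : ℤ, x ^ 2 = p * x - q := by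
  rw [minpoly.isIntegrallyClosed_eq_field_fractions' ℚ hx,
    (minpoly.monic hx).natDegree_map] at h
  have h1 := minpoly.aeval ℤ x
  have h2 : (minpoly ℤ x).coeff 2 = 1 := by
    rw [← h]
    exact minpoly.monic hx
  rw [Polynomial.aeval_eq_sum_range, h] at h1
  simp only [Finset.sum_range_succ, Finset.sum_range_zero, h2, zsmul_eq_mul, pow_zero] at h1
  refine ⟨-(minpoly ℤ x).coeff 1, (minpoly ℤ x).coeff 0, ?_⟩
  push_cast at h1 ⊢
  linear_combination h1

theorem natDegree_minpoly_inv (x : ℝ) (hx : IsIntegral ℚ x) :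
    (minpoly ℚ x⁻¹).natDegree = (minpoly ℚ x).natDegree := by
  rw [← IntermediateField.adjoin.finrank hx, ← IntermediateField.adjoin.finrank hx.inv]
  have : IntermediateField.adjoin ℚ {x⁻¹} = IntermediateField.adjoin ℚ {x} := by
    apply le_antisymm
    · rw [IntermediateField.adjoin_simple_le_iff]
      exact inv_mem (IntermediateField.mem_adjoin_simple_self ℚ x)
    · rw [IntermediateField.adjoin_simple_le_iff]
      simpa using inv_mem (IntermediateField.mem_adjoin_simple_self ℚ x⁻¹)
  rw [this]

theorem IsQuadraticPisotUnit.exists_isConjugateUnitPair {β : ℝ} (hβ : IsQuadraticPisotUnit β) :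
    ∃ (β' : ℝ) (m ε : ℤ), IsConjugateUnitPair β β' m ε := by
  have hirr := irrational_of_natDegree_minpoly_eq_two hβ.natDegree_minpoly
  obtain ⟨m, ε, hm⟩ := exists_sq_eq_of_natDegree_minpoly_eq_two hβ.isIntegral hβ.natDegree_minpoly
  obtain ⟨p, q, hp⟩ := exists_sq_eq_of_natDegree_minpoly_eq_two hβ.isIntegral_inv
    ((natDegree_minpoly_inv β hβ.isIntegral.tower_top).trans hβ.natDegree_minpoly)
  have h1 := hβ.one_lt
  have hinv : β * β⁻¹ = 1 := mul_inv_cancel₀ (by linarith)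
  -- The equation `β⁻² = p β⁻¹ - q` times `β²`, reduced by `β² = m β - ε`. Irrationality of `β` then
  -- gives `q ε = 1`, so the norm is a unit.
  have h2 : linEval β (1 - q * ε, q * m - p) = 0 := by
    rw [linEval_apply]
    push_cast
    linear_combination (-β * β⁻¹ - 1 + p * β) * hinv + β ^ 2 * hp - q * hm
  rw [← map_zero (linEval β)] at h2
  have h3 := IsConjugateUnitPair.linEval_injective_of_irrational hirr h2
  have h4 : 1 - q * ε = 0 := congrArg Prod.fst h3
  refine ⟨m - β, m, ε, hirr, by ring, by linear_combination -hm, ?_, ?_⟩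
  · exact Int.isUnit_iff.1 (IsUnit.of_mul_eq_one q (by linarith))
  · rw [abs_of_pos (by linarith)]; exact h1

theorem theorem2 (β : ℝ) (hβ : IsQuadraticPisotUnit β)
    (A : Finset ℤ) (hA : ∃ a b : ℤ, A = Finset.Icc a b) (h0 : (0 : ℤ) ∈ A)
    (hcard : β < (A.card : ℝ))
    (α : ℝ) (hα : α = -β ∨ (α = β ∧ ({-1, 0, 1} : Finset ℤ) ⊆ A)) :
    ∃ Δ₁ Δ₂ : ℝ, 0 < Δ₁ ∧ 0 < Δ₂ ∧ Δ₁ ≠ Δ₂ ∧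
      (∀ x y : ℝ, AreConsecutive (digitSpectrum A α) x y →
        y - x ∈ ({Δ₁, Δ₂, Δ₁ + Δ₂} : Set ℝ)) ∧
      ∃ y : ℤ → ℝ, StrictMono y ∧ Set.range y = digitSpectrum A α ∧
        ∃ (lam mu : ℝ) (J IA IB IC : Set ℝ) (T : Equiv.Perm J) (ρ : J),
          IsThreeIntervalExchange lam mu J IA IB IC T ∧
          CodesOrbit (fun n => y (n + 1) - y n) Δ₁ (Δ₁ + Δ₂) Δ₂ J IA IB IC T ρ ∧
          (∀ α' : ℝ, Polynomial.aeval α' (minpoly ℚ α) = 0 → α' ≠ α →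
            ¬ (sInf (digitSpectrum A α') ∈
                  (Algebra.adjoin ℤ {β} : Set ℝ) \ digitSpectrum A α' ∧
                sSup (digitSpectrum A α') ∈
                  (Algebra.adjoin ℤ {β} : Set ℝ) \ digitSpectrum A α') →
            AreLeftClosedRightOpen lam mu J IA IB IC) := by
  obtain ⟨a, b, rfl⟩ := hA
  obtain ⟨ha, hb⟩ := Finset.mem_Icc.1 h0
  have hβ1 := hβ.one_lt
  have hab : β < b - a + 1 := by
    rw [Int.card_Icc] at hcard
    have : (((b + 1 - a).toNat : ℤ) : ℝ) = ((b + 1 - a : ℤ) : ℝ) := by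
      rw [Int.toNat_of_nonneg (by omega)]
    push_cast at this
    linarith
  have hab' : a < b := by
    have : (a : ℝ) < b := by linarith
    exact_mod_cast this
  obtain ⟨β', m, ε, hpair⟩ := hβ.exists_isConjugateUnitPair
  have hconj : ∃ (α' : ℝ) (M : ℤ), IsConjugateUnitPair α α' M ε := by
    rcases hα with rfl | ⟨rfl, -⟩
    · exact ⟨_, _, hpair.neg⟩
    · exact ⟨_, _, hpair⟩
  obtain ⟨α', M, h⟩ := hconj
  have hfill : FillsWindow α α' a b := by
    refine h.fillsWindow hβ1 ha hb hab (hα.imp_right fun hα => ⟨hα.1, ?_, ?_⟩)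
    · exact (Finset.mem_Icc.1 (hα.2 (by simp))).1
    · exact (Finset.mem_Icc.1 (hα.2 (by simp))).2
  have hαmem : α ∈ Algebra.adjoin ℤ {β} := by
    have := Algebra.self_mem_adjoin_singleton ℤ β
    rcases hα with rfl | ⟨rfl, -⟩
    · exact neg_mem this
    · exact this
  have hR : ∀ z, linEval α' z ∈ (Algebra.adjoin ℤ {β} : Set ℝ) := by
    intro z
    rw [linEval_apply, ← sub_eq_of_eq_add' h.add_eq.symm]
    exact add_mem (intCast_mem _ _) (mul_mem (intCast_mem _ _) (sub_mem (intCast_mem _ _) hαmem))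
  obtain ⟨Δ₁, Δ₂, h1, h2, h3, h4, y, hy, hyX, lam, mu, J, IA, IB, IC, T, ρ, h5, h6, h7⟩ :=
    h.exists_codesOrbit hfill ha hb hab' hR
  refine ⟨Δ₁, Δ₂, h1, h2, h3, h4, y, hy, hyX, lam, mu, J, IA, IB, IC, T, ρ, h5, h6, ?_⟩
  intro x hx hne hQ
  obtain rfl := h.eq_conj_of_aeval_minpoly hx hne
  exact h7 hQ
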